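/- Let $\mathcal A$ be an essentially small exact category (in the sense of Quillen). A strict cocompletion of $\mathcal A$ is a cocomplete abelian category $\mathcal A^\vee$ containing $\mathcal A$ as a full subcategory such that: (i) a sequence $X\to Y\to Z$ in $\mathcal A$ is a conflation if and only if $0\to X\to Y\to Z\to 0$ is exact in $\mathcal A^\vee$; (ii) every object of $\mathcal A$ is finitely presented in $\mathcal A^\vee$, i.e. $\mathrm{Hom}(X,-)$ commutes with filtered colimits for every $X\in\mathcal A$; (iii) for every non-zero object $Y$ of $\mathcal A^\vee$ there are $X\in\mathcal A$ and a non-zero morphism $X\to Y$; (iv) for every $X\in\mathcal A$, every epimorphism $\varphi:U\to V$ in $\mathcal A^\vee$ and every morphism $f:X\to V$ there are a deflation $g:Y\to X$ in $\mathcal A$ and a morphism $h:Y\to U$ with $\varphi h=fg$. (It is a known fact, not part of the claim, that a strict cocompletion exists and is unique up to equivalence, so that regularity below does not depend on its choice.) A class of objects of $\mathcal A^\vee$ is called exact if, whenever two of the objects $X,Y,Z$ of a short exact sequence $0\to X\to Y\to Z\to 0$ in $\mathcal A^\vee$ belong to it, so does the third, and cocomplete if it is stable under filtered colimits. The category $\mathcal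 A$ is called regular if the class of all objects of $\mathcal A^\vee$ is the only exact and cocomplete class in $\mathcal A^\vee$ that contains $\mathcal A$. Let $\mathcal A$ be a regular essentially small exact category and let $\mathcal A^\vee$ be a strict cocompletion of $\mathcal A$. Let $C=(\cdots\to C_{i+1}\to C_i\to C_{i-1}\to\cdots)$ be a $\mathbf Z$-graded chain complex of objects of $\mathcal A$ whose homology $H_i(C)$, computed in $\mathcal A^\vee$, vanishes for all large enough $i$. Then there is an integer $n$ such that, for every $i\ge n$, the kernel in $\mathcal A^\vee$ of $d:C_i\to C_{i-1}$ is a direct summand in $\mathcal A^\vee$ of an object of $\mathcal A$. In particular, if $M$ is an object of $\mathcal A^\vee$ and $\cdots\to C_2\to C_1\to C_0\to M\to 0$ is an exact sequence in $\mathcal A^\vee$ with $C_i\in\mathcal A$ for all $i\ge 0$, then for all $i$ large enough the kernel of $d:C_i\to C_{i-1}$ is a direct summand of an object of $\mathcal A$. -/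

import Mathlib

open CategoryTheory CategoryTheory.Limits

universe w v u u'

/-- An exact structure, in the sense of Quillen, on an additive category `A`: a class of
kernel-cokernel pairs `X ⟶ Y ⟶ Z` (the conflations), whose first maps are the inflations and
whose second maps are the deflations. -/
structure ExactStructure (A : Type u) [Category.{v} A] [Preadditive A] [HasZeroObject A]
    [HasBinaryBiproducts A] where
  /-- The class of conflations. -/
  conflation : ShortComplex A → Prop
  /-- The class of inflations. -/
  inflation : MorphismProperty A
  /-- The class of deflations. -/
  deflation : MorphismProperty A
  inflation_iff : ∀ {X Y : A} (f : X ⟶ Y), inflation f ↔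
    ∃ (Z : A) (g : Y ⟶ Z) (w : f ≫ g = 0), conflation (ShortComplex.mk f g w)
  deflation_iff : ∀ {Y Z : A} (g : Y ⟶ Z), deflation g ↔
    ∃ (X : A) (f : X ⟶ Y) (w : f ≫ g = 0), conflation (ShortComplex.mk f g w)
  conflation_of_iso : ∀ {S T : ShortComplex A}, (S ≅ T) → conflation S → conflation T
  isKernel : ∀ S : ShortComplex A, conflation S → Nonempty (IsLimit (KernelFork.ofι S.f S.zero))
  isCokernel : ∀ S : ShortComplex A, conflation S →
    Nonempty (IsColimit (CokernelCofork.ofπ S.g S.zero))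
  inflation_of_isIso : ∀ {X Y : A} (f : X ⟶ Y) [IsIso f], inflation f
  deflation_of_isIso : ∀ {X Y : A} (f : X ⟶ Y) [IsIso f], deflation f
  inflation_comp : ∀ {X Y Z : A} (f : X ⟶ Y) (g : Y ⟶ Z),
    inflation f → inflation g → inflation (f ≫ g)
  deflation_comp : ∀ {X Y Z : A} (f : X ⟶ Y) (g : Y ⟶ Z),
    deflation f → deflation g → deflation (f ≫ g)
  /-- Cobase change of inflations. -/
  cobaseChange : ∀ {X Y X' : A} (f : X ⟶ Y) (g : X ⟶ X'), inflation f →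
    ∃ (Y' : A) (f' : X' ⟶ Y') (g' : Y ⟶ Y'), IsPushout f g g' f' ∧ inflation f'
  /-- Base change of deflations. -/
  baseChange : ∀ {X Y Y' : A} (f : X ⟶ Y) (g : Y' ⟶ Y), deflation f →
    ∃ (X' : A) (f' : X' ⟶ Y') (g' : X' ⟶ X), IsPullback g' f' f g ∧ deflation f'

section Cocompletion

variable {A : Type u} [Category.{v} A] [Preadditive A] [HasZeroObject A] [HasBinaryBiproducts A]
  {B : Type u'} [Category.{w} B] [Abelian B]

/-- The functor `F` from the exact category `(A, E)` to the abelian category `B` is a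
cocompletion. It is a strict cocompletion when `F` is moreover the inclusion of a subcategory. -/
structure IsCocompletion (E : ExactStructure A) (F : A ⥤ B) [F.Additive] : Prop where
  /-- `B` is cocomplete. -/
  hasColimits : HasColimits B
  /-- `F` is fully exact: fully faithful, and it preserves and reflects conflations. -/
  full : F.Full
  faithful : F.Faithful
  conflation_iff : ∀ S : ShortComplex A, E.conflation S ↔ (S.map F).ShortExact
  /-- The objects of `A` are finitely presented in `B`. -/
  finitelyPresented : ∀ X : A, IsFinitelyPresentable.{w} (F.obj X)
  exists_ne_zero : ∀ Y : B, ¬ IsZero Y → ∃ (X : A) (f : F.obj X ⟶ Y), f ≠ 0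
  exists_lift : ∀ (X : A) {U V : B} (φ : U ⟶ V) [Epi φ] (f : F.obj X ⟶ V),
    ∃ (Y : A) (g : Y ⟶ X) (h : F.obj Y ⟶ U), E.deflation g ∧ h ≫ φ = F.map g ≫ f

/-- A class of objects of an abelian category is exact if, as soon as two of the objects of a
short exact sequence are in the class, so is the third one. -/
structure IsExactClass (P : ObjectProperty B) : Prop where
  left : ∀ S : ShortComplex B, S.ShortExact → P S.X₂ → P S.X₃ → P S.X₁
  middle : ∀ S : ShortComplex B, S.ShortExact → P S.X₁ → P S.X₃ → P S.X₂
  right : ∀ S : ShortComplex B, S.ShortExact → P S.X₁ → P S.X₂ → P S.X₃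

/-- A class of objects is cocomplete if it is stable under (small) filtered colimits. -/
def IsCocompleteClass (P : ObjectProperty B) : Prop :=
  ∀ (J : Type w) [SmallCategory J] [IsFiltered J] (D : J ⥤ B) (c : Cocone D),
    Nonempty (IsColimit c) → (∀ j, P (D.obj j)) → P c.pt

/-- `A`, with its cocompletion `F : A ⥤ B`, is regular: the class of all objects is the only
cocomplete exact class in `B` containing `A`. -/
def IsRegularExact (F : A ⥤ B) : Prop :=
  ∀ P : ObjectProperty B, IsExactClass P → IsCocompleteClass P → (∀ X : A, P (F.obj X)) →
    ∀ Y : B, P Y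

/-- `Z` is a direct summand in `B` of an object of `A`. -/
def IsSummandOfObj (F : A ⥤ B) (Z : B) : Prop :=
  ∃ (X : A) (W : B), Nonempty (Z ⊞ W ≅ F.obj X)

/-- An `A`-resolution of an object `M` of `B`: an exact sequence
`⋯ ⟶ C₂ ⟶ C₁ ⟶ C₀ ⟶ M ⟶ 0` in `B` with all the `Cᵢ` in `A`. -/
structure ObjResolution (F : A ⥤ B) [F.Additive] (M : B) where
  /-- The complex `⋯ ⟶ C₂ ⟶ C₁ ⟶ C₀`. -/
  complex : ChainComplex A ℕ
  /-- The augmentation. -/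
  π : F.obj (complex.X 0) ⟶ M
  zero : F.map (complex.d 1 0) ≫ π = 0
  epi : Epi π
  exact_zero : (ShortComplex.mk (F.map (complex.d 1 0)) π zero).Exact
  exact_succ : ∀ n : ℕ, ((F.mapHomologicalComplex _).obj complex).ExactAt (n + 1)

end Cocompletion

/-! In the derived category of `B`, let the cells of degree `n` be the `X⟦n⟧` with `X` in `A`.
Lifting along deflations shows that a map from a cell of degree `n` to an object `≤ -(n + 1)`
factors through a cell of degree `n + 1`; finite presentability then shows that `Hom` from a cell
commutes with filtered colimits in `B`.

Take syzygies `0 → Z (k+1) → C k → Z k → 0`. Modulo objects of arbitrarily low cohomological degree,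
`Z 0` is built from finitely many cells, so it is pseudo-coherent. The objects of `B` such that
every map to them from a pseudo-coherent object factors through a finite object form an exact
cocomplete class containing `A`; by regularity this is all of `B`
(`IsRegularExact.isFinitelyReachable`). Hence the identity of `Z 0` factors through a finite object,
and `Z 0` has finite dimension in the sense of `DimLE`, because attaching one cell, of whatever
degree, keeps the dimension finite.

For `k` large, the iterated connecting map `Z 0 → (Z k)⟦k⟧` thus factors through some `X⟦k⟧`. Its
cone has dimension `≤ k + 1`, which forces the kernel of `C k ⊞ X → Z k` to be a retract of an
object of `A`. This kernel maps onto `X` with kernel `Z (k+1)`, and so `Z (k+1)` is a retract too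
(`exists_retract_syzygy`). -/

open CategoryTheory.Pretriangulated CategoryTheory.Triangulated

/-! ### Cells and cellular dimension in a triangulated category with a t-structure. -/

section TriangulatedCells

variable {D : Type u} [Category.{v} D] [Preadditive D] [HasZeroObject D] [HasShift D ℤ]
  [∀ n : ℤ, (shiftFunctor D n).Additive] [Pretriangulated D]

section Exactness

variable {X Y Z W : D} {p : X ⟶ Y} {q : Y ⟶ Z} {r : Z ⟶ X⟦(1 : ℤ)⟧}

lemma distTriang_comp₁₂ (hT : Triangle.mk p q r ∈ distTriang D) : p ≫ q = 0 :=
  comp_distTriang_mor_zero₁₂ _ hT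

lemma distTriang_comp₂₃ (hT : Triangle.mk p q r ∈ distTriang D) : q ≫ r = 0 :=
  comp_distTriang_mor_zero₂₃ _ hT

lemma distTriang_comp₃₁ (hT : Triangle.mk p q r ∈ distTriang D) : r ≫ p⟦(1 : ℤ)⟧' = 0 :=
  comp_distTriang_mor_zero₃₁ _ hT

lemma distTriang_desc₂ (hT : Triangle.mk p q r ∈ distTriang D) (f : Y ⟶ W) (hf : p ≫ f = 0) :
    ∃ g : Z ⟶ W, f = q ≫ g :=
  Triangle.yoneda_exact₂ _ hT f hf

lemma distTriang_desc₃ (hT : Triangle.mk p q r ∈ distTriang D) (f : Z ⟶ W) (hf : q ≫ f = 0) :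
    ∃ g : X⟦(1 : ℤ)⟧ ⟶ W, f = r ≫ g :=
  Triangle.yoneda_exact₃ _ hT f hf

lemma distTriang_lift₂ (hT : Triangle.mk p q r ∈ distTriang D) (f : W ⟶ Y) (hf : f ≫ q = 0) :
    ∃ g : W ⟶ X, f = g ≫ p :=
  Triangle.coyoneda_exact₂ _ hT f hf

lemma distTriang_rotate (hT : Triangle.mk p q r ∈ distTriang D) :
    Triangle.mk q r (-p⟦(1 : ℤ)⟧') ∈ distTriang D :=
  rot_of_distTriang _ hT

/-- A morphism out of the first object of a distinguished triangle extends to the second object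
as soon as its shift is killed by the third morphism. -/
lemma distTriang_desc₁ (hT : Triangle.mk p q r ∈ distTriang D) (f : X ⟶ W)
    (hf : r ≫ f⟦(1 : ℤ)⟧' = 0) :
    ∃ g : Y ⟶ W, f = p ≫ g := by
  obtain ⟨g, hg⟩ := distTriang_desc₃ (distTriang_rotate hT) (f⟦(1 : ℤ)⟧') hf
  obtain ⟨g', rfl⟩ := (shiftFunctor D (1 : ℤ)).map_surjective g
  refine ⟨-g', (shiftFunctor D (1 : ℤ)).map_injective ?_⟩
  rw [hg, Preadditive.comp_neg, Functor.map_neg, Functor.map_comp, Preadditive.neg_comp]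

end Exactness

/-- Homotopy cobase change: if the restriction of `f` to the first object of a distinguished
triangle factors through `V`, then `f` is the sum of a morphism which factors through the cobase
change of the triangle to `V` and of a morphism which factors through the third object. -/
lemma exists_cobaseChange_of_distTriang {T₁ T T₂ V W : D} {p : T₁ ⟶ T} {q : T ⟶ T₂}
    {r : T₂ ⟶ T₁⟦(1 : ℤ)⟧} (hT : Triangle.mk p q r ∈ distTriang D) (f : T ⟶ W)
    (b : T₁ ⟶ V) (a : V ⟶ W) (hf : p ≫ f = b ≫ a) :
    ∃ (T' : D) (p' : V ⟶ T') (q' : T' ⟶ T₂) (m : T ⟶ T') (a' : T' ⟶ W) (c : T₂ ⟶ W),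
      Triangle.mk p' q' (r ≫ b⟦(1 : ℤ)⟧') ∈ distTriang D ∧ f = m ≫ a' + q ≫ c := by
  obtain ⟨T', p', q', hT'⟩ := distinguished_cocone_triangle₂ (r ≫ b⟦(1 : ℤ)⟧')
  obtain ⟨m, hm⟩ : ∃ m : T ⟶ T', p ≫ m = b ≫ p' := by
    obtain ⟨m, hm, -⟩ := complete_distinguished_triangle_morphism₂ _ _ hT hT' b (𝟙 T₂)
      (Category.id_comp _).symm
    exact ⟨m, hm⟩
  obtain ⟨a', ha'⟩ := distTriang_desc₁ hT' a (by
    rw [Category.assoc, ← Functor.map_comp, ← hf, Functor.map_comp,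
      reassoc_of% (distTriang_comp₃₁ hT), zero_comp])
  obtain ⟨c, hc⟩ := distTriang_desc₂ hT (f - m ≫ a') (by
    rw [Preadditive.comp_sub, reassoc_of% hm, ← ha', hf, sub_self])
  exact ⟨T', p', q', m, a', c, hT', by rw [← hc]; abel⟩

/-- The cells of degree `n`, for all integers `n`, in a triangulated category with a t-structure:
a class of objects which is stable under extensions and such that each morphism from a cell of
degree `n` to an object `≤ -(n + 1)` factors through a cell of degree `n + 1` in such a way that
the fibre of the first factor is a cell of degree `n`. -/
structure CellFamily (t : TStructure D) where
  /-- The class of cells of a given degree. -/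
  cell : ℤ → ObjectProperty D
  shift : ∀ {n : ℤ} {X : D} (a n' : ℤ), cell n X → n + a = n' → cell n' (X⟦a⟧)
  isLE : ∀ {n : ℤ} {X : D}, cell n X → t.IsLE X (-n)
  ext : ∀ {n : ℤ} {X Y Z : D} {p : X ⟶ Y} {q : Y ⟶ Z} {r : Z ⟶ X⟦(1 : ℤ)⟧},
    Triangle.mk p q r ∈ distTriang D → cell n X → cell n Z → cell n Y
  exists_cell : ∀ n : ℤ, ∃ K : D, cell n K
  efface : ∀ {n : ℤ} {X W : D}, cell n X → t.IsLE W (-(n + 1)) → ∀ f : X ⟶ W,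
    ∃ (X' K : D) (p : X' ⟶ X) (q : X ⟶ K) (r : K ⟶ X'⟦(1 : ℤ)⟧) (g : K ⟶ W),
      Triangle.mk p q r ∈ distTriang D ∧ cell n X' ∧ cell (n + 1) K ∧ f = q ≫ g

namespace CellFamily

variable {t : TStructure D} (𝒞 : CellFamily t)

/-- All morphisms from `T` to the objects `≤ -n` factor through cells of degree `n`. -/
def DimLE (n : ℤ) : ObjectProperty D := fun T ↦
  ∀ ⦃W : D⦄, t.IsLE W (-n) → ∀ f : T ⟶ W,
    ∃ (K : D) (a : T ⟶ K) (b : K ⟶ W), 𝒞.cell n K ∧ f = a ≫ b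

/-- The finite objects: those obtained from zero by adding finitely many cells. -/
inductive IsFinite : D → Prop
  | zero {T : D} (hT : IsZero T) : IsFinite T
  | cell {T₁ T X : D} {n : ℤ} {p : T₁ ⟶ T} {q : T ⟶ X} {r : X ⟶ T₁⟦(1 : ℤ)⟧}
      (hT : Triangle.mk p q r ∈ distTriang D) (h₁ : IsFinite T₁) (hX : 𝒞.cell n X) : IsFinite T

variable {𝒞}

lemma cell_biprod {n : ℤ} {K L : D} (hK : 𝒞.cell n K) (hL : 𝒞.cell n L) :
    𝒞.cell n (K ⊞ L) :=
  𝒞.ext (binaryBiproductTriangle_distinguished K L) hK hL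

lemma exists_factor_add {n : ℤ} {T W : D} {f g : T ⟶ W}
    (hf : ∃ (K : D) (a : T ⟶ K) (b : K ⟶ W), 𝒞.cell n K ∧ f = a ≫ b)
    (hg : ∃ (K : D) (a : T ⟶ K) (b : K ⟶ W), 𝒞.cell n K ∧ g = a ≫ b) :
    ∃ (K : D) (a : T ⟶ K) (b : K ⟶ W), 𝒞.cell n K ∧ f + g = a ≫ b := by
  obtain ⟨K, a, b, hK, rfl⟩ := hf
  obtain ⟨L, c, d, hL, rfl⟩ := hg
  exact ⟨K ⊞ L, biprod.lift a c, biprod.desc b d, cell_biprod hK hL, by simp⟩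

lemma DimLE.of_cell {n n' : ℤ} {X : D} (hX : 𝒞.cell n X) (hn : n + 1 = n' := by lia) :
    𝒞.DimLE n' X := by
  subst hn
  intro W hW f
  obtain ⟨-, K, -, q, -, g, -, -, hK, rfl⟩ := 𝒞.efface hX hW f
  exact ⟨K, q, g, hK, rfl⟩

lemma DimLE.succ {n n' : ℤ} {T : D} (hT : 𝒞.DimLE n T) (hn : n + 1 = n' := by lia) :
    𝒞.DimLE n' T := by
  intro W hW f
  obtain ⟨K, a, b, hK, rfl⟩ := hT (t.isLE_of_le W (-n') (-n)) f
  obtain ⟨L, c, d, hL, rfl⟩ := DimLE.of_cell hK hn hW b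
  exact ⟨L, a ≫ c, d, hL, by simp⟩

lemma DimLE.mono {n n' : ℤ} {T : D} (hT : 𝒞.DimLE n T) (hn : n ≤ n') : 𝒞.DimLE n' T := by
  induction n', hn using Int.leInduction with
  | base => exact hT
  | succ k _ ih => exact ih.succ

lemma DimLE.of_cell_of_lt {n n' : ℤ} {X : D} (hX : 𝒞.cell n X) (hn : n < n') :
    𝒞.DimLE n' X :=
  (DimLE.of_cell hX rfl).mono hn

lemma DimLE.of_retract {n : ℤ} {X T : D} (hT : 𝒞.DimLE n T) (h : Retract X T) :
    𝒞.DimLE n X := by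
  intro W hW f
  obtain ⟨K, a, b, hK, hf⟩ := hT hW (h.r ≫ f)
  exact ⟨K, h.i ≫ a, b, hK, by rw [Category.assoc, ← hf, h.retract_assoc]⟩

lemma DimLE.of_shift {n : ℤ} {T : D} (a n' : ℤ) (hT : 𝒞.DimLE n' (T⟦a⟧)) (hn : n + a = n') :
    𝒞.DimLE n T := by
  intro W hW f
  obtain ⟨K, b, c, hK, hf⟩ := hT (t.isLE_shift W (-n) a (-n')) (f⟦a⟧')
  have e := (shiftFunctorCompIsoId D a (-a) (by simp))
  refine ⟨K⟦-a⟧, e.inv.app T ≫ b⟦-a⟧', c⟦-a⟧' ≫ e.hom.app W, 𝒞.shift _ _ hK (by lia), ?_⟩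
  have := e.hom.naturality f
  dsimp at this
  rw [Category.assoc, ← Functor.map_comp_assoc, ← hf, this]
  simp

lemma DimLE.of_isZero {T : D} (hT : IsZero T) (n : ℤ) : 𝒞.DimLE n T := by
  intro W _ f
  obtain ⟨K, hK⟩ := 𝒞.exists_cell n
  exact ⟨K, 0, 0, hK, hT.eq_of_src _ _⟩

/-- Adding a cell of degree `n`. -/
lemma DimLE.of_distTriang_cell {n n' : ℤ} {X Y Z : D} {p : X ⟶ Y} {q : Y ⟶ Z} {r : Z ⟶ X⟦(1 : ℤ)⟧}
    (hT : Triangle.mk p q r ∈ distTriang D)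
    (h₁ : 𝒞.DimLE n X) (h₃ : 𝒞.cell n Z) (hn : n + 1 = n' := by lia) :
    𝒞.DimLE n' Y := by
  intro W hW f
  obtain ⟨K, b, a, hK, hf⟩ := h₁ (t.isLE_of_le W (-n') (-n)) (p ≫ f)
  obtain ⟨E, p', q', m, a', c, hE, rfl⟩ := exists_cobaseChange_of_distTriang hT f b a hf
  have hE' : 𝒞.cell n E := 𝒞.ext hE hK h₃
  apply exists_factor_add
  · obtain ⟨L, x, y, hL, rfl⟩ := DimLE.of_cell hE' hn hW a'
    exact ⟨L, m ≫ x, y, hL, by simp⟩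
  · obtain ⟨L, x, y, hL, rfl⟩ := DimLE.of_cell h₃ hn hW c
    exact ⟨L, q ≫ x, y, hL, by simp⟩

variable [IsTriangulated D]

/-- A morphism from a cell of degree `i` to an object `≤ -n` with `i < n` factors through a cell
of degree `n`, and the first factor may be assumed to have a cone of dimension `≤ n + 1`. -/
lemma exists_factor_of_lt {i n : ℤ} (hn : i + 1 ≤ n) {X : D} (hX : 𝒞.cell i X) :
    ∀ ⦃W : D⦄, t.IsLE W (-n) → ∀ f : X ⟶ W,
    ∃ (K G : D) (c : X ⟶ K) (p : K ⟶ G) (q : G ⟶ X⟦(1 : ℤ)⟧) (g : K ⟶ W),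
      Triangle.mk c p q ∈ distTriang D ∧ 𝒞.cell n K ∧ 𝒞.DimLE (n + 1) G ∧ f = c ≫ g := by
  induction n, hn using Int.leInduction with
  | base =>
    intro W hW f
    obtain ⟨X', K, p, q, r, g, hT, hX', hK, rfl⟩ := 𝒞.efface hX hW f
    exact ⟨K, _, q, r, _, g, distTriang_rotate hT, hK,
      DimLE.of_cell (𝒞.shift 1 _ hX' rfl), rfl⟩
  | succ n _ ih =>
    intro W hW f
    obtain ⟨K, G, c, p, q, g, hT, hK, hG, rfl⟩ := ih (t.isLE_of_le W (-(n + 1)) (-n)) f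
    -- The cone of `X ⟶ K ⟶ L` is an extension of `K'⟦1⟧`, a cell of degree `n + 1`, by `G`, so its
    -- dimension grows by one only.
    obtain ⟨K', L, p', q', r', g', hT', hK', hL, rfl⟩ := 𝒞.efface hK hW g
    obtain ⟨G', a, b, hG'⟩ := distinguished_cocone_triangle (c ≫ q')
    have o := someOctahedron rfl hT (distTriang_rotate hT') hG'
    exact ⟨L, G', c ≫ q', a, b, g', hG', hL,
      DimLE.of_distTriang_cell o.mem hG (𝒞.shift 1 _ hK' rfl), by simp⟩

/-- The map `r` is factored through a cell `K` of degree `n`, although its target is a cell of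
degree `n + 1`: the cone of `K ⟶ X⟦1⟧` is then an extension of cells of degree `n + 1`, hence a
cell. The octahedron presents `Y⟦1⟧` as an extension of this cell by the cone of `Z ⟶ K`, of
dimension `≤ n + 1`. -/
lemma DimLE.of_two_cells {i n n' : ℤ} (hi : i < n) {X Y Z : D} {p : X ⟶ Y}
    {q : Y ⟶ Z} {r : Z ⟶ X⟦(1 : ℤ)⟧} (hT : Triangle.mk p q r ∈ distTriang D)
    (h₁ : 𝒞.cell n X) (h₃ : 𝒞.cell i Z) (hn : n + 1 = n' := by lia) :
    𝒞.DimLE n' Y := by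
  have := 𝒞.isLE h₁
  have : t.IsLE (X⟦(1 : ℤ)⟧) (-n) :=
    have := t.isLE_shift X (-n) 1 (-n - 1)
    t.isLE_of_le _ (-n - 1) _
  obtain ⟨K, G, c, p, q, g, hc, hK, hG, hf⟩ := exists_factor_of_lt hi h₃ this r
  obtain ⟨E, a, b, hE⟩ := distinguished_cocone_triangle g
  have hE' : 𝒞.cell n' E := 𝒞.ext (distTriang_rotate hE) (𝒞.shift 1 _ h₁ hn)
    (𝒞.shift 1 _ hK hn)
  have o := someOctahedron hf.symm hc hE (distTriang_rotate (distTriang_rotate hT))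
  subst hn
  exact DimLE.of_shift 1 _ (DimLE.of_distTriang_cell o.mem hG hE' rfl) rfl

/-- Cells may thus be attached in any order of degrees: homotopy cobase change replaces `X` by a
single cell of degree `n`, which is the case of `DimLE.of_two_cells`. -/
lemma DimLE.of_distTriang_cell_of_lt {i n n' : ℤ} (hi : i < n) {X Y Z : D} {p : X ⟶ Y}
    {q : Y ⟶ Z} {r : Z ⟶ X⟦(1 : ℤ)⟧} (hT : Triangle.mk p q r ∈ distTriang D)
    (h₁ : 𝒞.DimLE n X) (h₃ : 𝒞.cell i Z)
    (hn : n + 1 = n' := by lia) : 𝒞.DimLE n' Y := by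
  intro W hW f
  obtain ⟨K, b, a, hK, hf⟩ := h₁ (t.isLE_of_le W (-n') (-n)) (p ≫ f)
  obtain ⟨E, p', q', m, a', c, hE, rfl⟩ := exists_cobaseChange_of_distTriang hT f b a hf
  apply exists_factor_add
  · obtain ⟨L, x, y, hL, rfl⟩ := DimLE.of_two_cells hi hE hK h₃ hn hW a'
    exact ⟨L, m ≫ x, y, hL, by simp⟩
  · obtain ⟨L, x, y, hL, rfl⟩ := DimLE.of_cell_of_lt h₃ (by lia) hW c
    exact ⟨L, q ≫ x, y, hL, by simp⟩

end CellFamily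

end TriangulatedCells

/-! ### Finite objects: extensions, dimension, and a criterion for retracts of cells. -/

section TriangulatedCells

variable {D : Type u} [Category.{v} D] [Preadditive D] [HasZeroObject D] [HasShift D ℤ]
  [∀ n : ℤ, (shiftFunctor D n).Additive] [Pretriangulated D]

/-- In a distinguished triangle, the objects may be replaced by isomorphic ones. -/
lemma exists_distTriang_of_iso {X Y Z X' Y' Z' : D} {p : X ⟶ Y} {q : Y ⟶ Z}
    {r : Z ⟶ X⟦(1 : ℤ)⟧} (hT : Triangle.mk p q r ∈ distTriang D) (e₁ : X ≅ X') (e₂ : Y ≅ Y')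
    (e₃ : Z ≅ Z') : Triangle.mk (e₁.inv ≫ p ≫ e₂.hom) (e₂.inv ≫ q ≫ e₃.hom)
      (e₃.inv ≫ r ≫ e₁.hom⟦(1 : ℤ)⟧') ∈ distTriang D := by
  refine isomorphic_distinguished _ hT _ (Triangle.isoMk _ _ e₁.symm e₂.symm e₃.symm ?_ ?_ ?_)
  · simp [Triangle.mk]
  · simp [Triangle.mk]
  · simp [Triangle.mk, ← Functor.map_comp]

/-- The shift of a distinguished triangle. -/
lemma distTriang_shift {X Y Z : D} {p : X ⟶ Y} {q : Y ⟶ Z} {r : Z ⟶ X⟦(1 : ℤ)⟧}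
    (hT : Triangle.mk p q r ∈ distTriang D) (a : ℤ) :
    ∃ r' : Z⟦a⟧ ⟶ X⟦a⟧⟦(1 : ℤ)⟧, Triangle.mk (p⟦a⟧') (q⟦a⟧') r' ∈ distTriang D := by
  have h := Triangle.shift_distinguished _ hT a
  -- Shifting a triangle multiplies its three maps by the sign `u`; rescaling the middle object
  -- moves all signs to the third map.
  let u : ℤˣ := a.negOnePow
  refine ⟨u • (r⟦a⟧' ≫ (shiftFunctorComm D 1 a).hom.app X), isomorphic_distinguished _ h _ ?_⟩
  have hu : (u • 𝟙 (Y⟦a⟧)) ≫ (u • 𝟙 (Y⟦a⟧)) = 𝟙 _ := by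
    rw [Linear.units_smul_comp, Category.id_comp, smul_smul]
    simp [u]
  refine Triangle.isoMk _ _ (Iso.refl (X⟦a⟧))
    ⟨u • 𝟙 (Y⟦a⟧), u • 𝟙 (Y⟦a⟧), hu, hu⟩ (Iso.refl (Z⟦a⟧)) ?_ ?_ ?_
  · change p⟦a⟧' ≫ (u • 𝟙 (Y⟦a⟧)) = 𝟙 _ ≫ (u • p⟦a⟧')
    rw [Linear.comp_units_smul, Category.id_comp, Category.comp_id]
  · change q⟦a⟧' ≫ 𝟙 _ = (u • 𝟙 (Y⟦a⟧)) ≫ (u • q⟦a⟧')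
    rw [Linear.comp_units_smul, Linear.units_smul_comp, smul_smul]
    simp [u]
  · change (u • (r⟦a⟧' ≫ (shiftFunctorComm D 1 a).hom.app X)) ≫ (𝟙 (X⟦a⟧))⟦(1 : ℤ)⟧' =
      𝟙 _ ≫ (u • (r⟦a⟧' ≫ (shiftFunctorComm D 1 a).hom.app X))
    rw [CategoryTheory.Functor.map_id]
    exact (Category.comp_id _).trans (Category.id_comp _).symm

namespace CellFamily

variable {t : TStructure D} {𝒞 : CellFamily t}

lemma IsFinite.of_cell {n : ℤ} {X : D} (hX : 𝒞.cell n X) : 𝒞.IsFinite X :=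
  .cell (contractible_distinguished₁ X) (.zero (isZero_zero D)) hX

lemma IsFinite.of_iso {T T' : D} (e : T ≅ T') (hT : 𝒞.IsFinite T) : 𝒞.IsFinite T' := by
  induction hT with
  | zero hT => exact .zero (hT.of_iso e.symm)
  | cell hT h₁ hX _ =>
    exact .cell (exists_distTriang_of_iso hT (Iso.refl _) e (Iso.refl _)) h₁ hX

lemma IsFinite.shift {T : D} (hT : 𝒞.IsFinite T) (a : ℤ) : 𝒞.IsFinite (T⟦a⟧) := by
  induction hT with
  | zero hT => exact .zero (Functor.map_isZero _ hT)
  | cell hT _ hX ih =>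
    obtain ⟨r', h⟩ := distTriang_shift hT a
    exact .cell h ih (𝒞.shift a _ hX rfl)

variable [IsTriangulated D]

lemma IsFinite.ext {X Y Z : D} {p : X ⟶ Y} {q : Y ⟶ Z} {r : Z ⟶ X⟦(1 : ℤ)⟧}
    (hT : Triangle.mk p q r ∈ distTriang D) (hX : 𝒞.IsFinite X) (hZ : 𝒞.IsFinite Z) :
    𝒞.IsFinite Y := by
  induction hZ generalizing Y with
  | zero hZ =>
    have : IsIso p := (Triangle.isZero₃_iff_isIso₁ _ hT).1 hZ
    exact hX.of_iso (asIso p)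
  | @cell Z₁ Z K n p' q' r' hZ h₁ hK ih =>
    -- Remove the last cell of `Z` from `Y`: the fibre `Y₁` is an extension of `Z₁` by `X`.
    obtain ⟨Y₁, a, b, hY⟩ := distinguished_cocone_triangle₁ (q ≫ q')
    have o := someOctahedron rfl (distTriang_rotate hT) (distTriang_rotate hZ)
      (distTriang_rotate hY)
    have h := exists_distTriang_of_iso (distTriang_shift o.mem (-1)).choose_spec
      ((shiftFunctorCompIsoId D (1 : ℤ) (-1) (by simp)).app X)
      ((shiftFunctorCompIsoId D (1 : ℤ) (-1) (by simp)).app Y₁)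
      ((shiftFunctorCompIsoId D (1 : ℤ) (-1) (by simp)).app Z₁)
    exact .cell hY (ih h) hK

lemma IsFinite.exists_dimLE {T : D} (hT : 𝒞.IsFinite T) :
    ∃ N : ℤ, ∀ n ≥ N, 𝒞.DimLE n T := by
  suffices ∃ N, 𝒞.DimLE N T by
    obtain ⟨N, hN⟩ := this
    exact ⟨N, fun n hn ↦ hN.mono hn⟩
  induction hT with
  | zero hT => exact ⟨0, DimLE.of_isZero hT 0⟩
  | @cell _ _ _ n _ _ _ hT _ hX ih =>
    obtain ⟨N, hN⟩ := ih
    -- The maximum puts the new cell in a degree strictly below the bound; attaching it costs one.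
    exact ⟨max N (n + 1) + 1, DimLE.of_distTriang_cell_of_lt
      (lt_of_lt_of_le (lt_add_one n) (le_max_right N (n + 1))) hT
        (hN.mono (le_max_left _ _)) hX rfl⟩

/-- Morphisms which factor through finite objects are stable under homotopy cobase change. -/
lemma IsFinite.exists_factor {Q' Q T W : D} {p : Q' ⟶ Q} {q : Q ⟶ T} {r : T ⟶ Q'⟦(1 : ℤ)⟧}
    (hT : Triangle.mk p q r ∈ distTriang D) (hfin : 𝒞.IsFinite T) (f : Q ⟶ W)
    (hf : ∃ (V : D) (b : Q' ⟶ V) (a : V ⟶ W), 𝒞.IsFinite V ∧ p ≫ f = b ≫ a) :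
    ∃ (V : D) (b : Q ⟶ V) (a : V ⟶ W), 𝒞.IsFinite V ∧ f = b ≫ a := by
  obtain ⟨V, b, a, hV, hf⟩ := hf
  obtain ⟨T', p', q', m, a', c, hT', rfl⟩ := exists_cobaseChange_of_distTriang hT f b a hf
  exact ⟨T' ⊞ T, biprod.lift m q, biprod.desc a' c,
    IsFinite.ext (binaryBiproductTriangle_distinguished T' T) (IsFinite.ext hT' hV hfin) hfin,
    by simp⟩

/-- The condition `hm` says that `q` factors through the cell `K`. The octahedron on `x ≫ k` gives a
triangle `Q ⟶ E ⟶ L` with third map `m ≫ q⟦1⟧' = 0`, so `Q` splits off `E`, which is a cell as an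
extension of `X⟦1⟧` by `K`. -/
lemma exists_retract_cell {n n' : ℤ} {X Z Q K L : D} {x : X ⟶ Z} {q : Z ⟶ Q}
    {r : Q ⟶ X⟦(1 : ℤ)⟧} (hQ : Triangle.mk x q r ∈ distTriang D)
    {k : Z ⟶ K} {l : K ⟶ L} {m : L ⟶ Z⟦(1 : ℤ)⟧} (hK : Triangle.mk k l m ∈ distTriang D)
    (hX : 𝒞.cell n X) (hK' : 𝒞.cell n' K) (hm : m ≫ q⟦(1 : ℤ)⟧' = 0)
    (hn : n + 1 = n' := by lia) :
    ∃ E : D, 𝒞.cell n' E ∧ Nonempty (Retract Q E) := by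
  obtain ⟨E, a, b, hE⟩ := distinguished_cocone_triangle (x ≫ k)
  have o := someOctahedron rfl hQ hK hE
  obtain ⟨s, hs⟩ := distTriang_desc₁ o.mem (𝟙 Q) (by simp [hm])
  exact ⟨E, 𝒞.ext (distTriang_rotate hE) hK' (𝒞.shift 1 _ hX hn), ⟨o.m₁, s, hs.symm⟩⟩

end CellFamily

end TriangulatedCells

/-! ### Effacing morphisms in the derived category by epimorphisms. -/

namespace DerivedCategory

variable {B : Type u'} [Category.{w} B] [Abelian B]

/-- The restriction to the top term of a complex concentrated in degrees `≤ n` is surjective on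
the homology in degree `n`. -/
lemma epi_homologyMap_mkHomFromSingle (K : CochainComplex B ℤ) (n : ℤ) [K.IsStrictlyLE n] :
    Epi (HomologicalComplex.homologyMap
      (HomologicalComplex.mkHomFromSingle (c := ComplexShape.up ℤ) (j := n) (𝟙 (K.X n))
        (fun k hk ↦ (K.isZero_of_isStrictlyLE n k
          (by rw [← show n + 1 = k from hk]; lia)).eq_of_tgt _ _)) n) := by
  set φ := HomologicalComplex.mkHomFromSingle (c := ComplexShape.up ℤ) (j := n) (𝟙 (K.X n))
        (fun k hk ↦ (K.isZero_of_isStrictlyLE n k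
          (by rw [← show n + 1 = k from hk]; lia)).eq_of_tgt _ _)
  have hφ : IsIso (φ.f n) := by
    rw [HomologicalComplex.mkHomFromSingle_f]; infer_instance
  have h₁ : IsIso (((HomologicalComplex.single B (ComplexShape.up ℤ) n).obj (K.X n)).iCycles n) :=
    HomologicalComplex.isIso_iCycles _ n _ rfl (by simp)
  have h₂ : IsIso (HomologicalComplex.cyclesMap φ n ≫ K.iCycles n) := by
    rw [HomologicalComplex.cyclesMap_i]; infer_instance
  have h₃ : IsIso (K.iCycles n) :=
    HomologicalComplex.isIso_iCycles _ n _ rfl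
      ((K.isZero_of_isStrictlyLE n _ (by simp)).eq_of_tgt _ _)
  have h₄ : IsIso (HomologicalComplex.cyclesMap φ n) := IsIso.of_isIso_comp_right _ (K.iCycles n)
  have : Epi (HomologicalComplex.homologyπ _ n ≫ HomologicalComplex.homologyMap φ n) := by
    rw [HomologicalComplex.homologyπ_naturality]; infer_instance
  exact epi_of_epi (HomologicalComplex.homologyπ _ n) _

variable [HasDerivedCategory.{v} B]

lemma exists_single_to_Q_obj (K : CochainComplex B ℤ) (n : ℤ) [K.IsStrictlyLE n] :
    ∃ φ : (singleFunctor B n).obj (K.X n) ⟶ Q.obj K, Epi ((homologyFunctor B n).map φ) := by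
  let φ := HomologicalComplex.mkHomFromSingle (c := ComplexShape.up ℤ) (j := n) (𝟙 (K.X n))
        (fun k hk ↦ (K.isZero_of_isStrictlyLE n k
          (by rw [← show n + 1 = k from hk]; lia)).eq_of_tgt _ _)
  refine ⟨Q.map φ, ?_⟩
  have h₁ : Epi (HomologicalComplex.homologyMap φ n) := epi_homologyMap_mkHomFromSingle K n
  have h₂ : Epi ((homologyFunctor B n).map (Q.map φ) ≫
      (homologyFunctorFactors B n).hom.app K) := by
    rw [homologyFunctorFactors_hom_naturality]
    exact epi_comp' inferInstance h₁
  have h₃ : (homologyFunctor B n).map (Q.map φ) = ((homologyFunctor B n).map (Q.map φ) ≫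
      (homologyFunctorFactors B n).hom.app K) ≫ (homologyFunctorFactors B n).inv.app K := by
    simp
  exact h₃ ▸ epi_comp' h₂ inferInstance

lemma epi_of_epi_homologyMap_singleFunctor_map {X Y : B} (p : X ⟶ Y) (n : ℤ)
    (hp : Epi ((homologyFunctor B n).map ((singleFunctor B n).map p))) : Epi p :=
  ((MorphismProperty.epimorphisms B).arrow_mk_iso_iff
    (Arrow.isoMk ((singleFunctorCompHomologyFunctorIso B n).app X)
      ((singleFunctorCompHomologyFunctorIso B n).app Y)
      ((singleFunctorCompHomologyFunctorIso B n).hom.naturality p).symm)).1 hp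

/-- Each morphism from an object of `B` to an object `< 0` of the derived category is killed by an
epimorphism in `B`. -/
lemma exists_epi_comp_eq_zero {X : B} {W : DerivedCategory B} (hW : W.IsLE (-1))
    (f : (singleFunctor B 0).obj X ⟶ W) :
    ∃ (U : B) (p : U ⟶ X), Epi p ∧ (singleFunctor B 0).map p ≫ f = 0 := by
  obtain ⟨U, i, r, hU⟩ := distinguished_cocone_triangle₁ f
  have : U.IsLE 0 := by
    have h1 : (W⟦(-1 : ℤ)⟧).IsLE 0 := TStructure.t.isLE_shift W (-1) (-1) 0
    exact TStructure.t.isLE₂ _ (inv_rot_of_distTriang _ hU) 0 h1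
      (inferInstanceAs (((singleFunctor B 0).obj X).IsLE 0))
  -- The top term of a complex representing the fibre `U` surjects onto its `H⁰`, which surjects
  -- onto `X` because `H⁰(W) = 0`.
  obtain ⟨K, hK, ⟨e⟩⟩ := exists_iso_Q_obj_of_isLE U 0
  obtain ⟨φ, hφ⟩ := exists_single_to_Q_obj K 0
  obtain ⟨p, hp⟩ := (singleFunctor B 0).map_surjective (φ ≫ e.inv ≫ i)
  refine ⟨K.X 0, p, epi_of_epi_homologyMap_singleFunctor_map p 0 ?_, ?_⟩
  · have h₁ : Epi ((homologyFunctor B 0).map i) :=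
      (HomologySequence.epi_homologyMap_mor₁_iff _ hU 0).2
        ((isZero_of_isLE W (-1) 0 (by lia)).eq_of_tgt _ _)
    rw [hp, Functor.map_comp, Functor.map_comp]
    infer_instance
  · rw [hp, Category.assoc, Category.assoc, distTriang_comp₁₂ hU, comp_zero, comp_zero]

end DerivedCategory

/-- Two distinguished triangles with the same third morphism have isomorphic second objects. -/
lemma exists_iso_of_distTriang {D : Type u} [Category.{v} D] [Preadditive D] [HasZeroObject D]
    [HasShift D ℤ] [∀ n : ℤ, (shiftFunctor D n).Additive] [Pretriangulated D]
    {X Y Y' Z : D} {p : X ⟶ Y} {q : Y ⟶ Z} {p' : X ⟶ Y'} {q' : Y' ⟶ Z} {r : Z ⟶ X⟦(1 : ℤ)⟧}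
    (hT : Triangle.mk p q r ∈ distTriang D) (hT' : Triangle.mk p' q' r ∈ distTriang D) :
    Nonempty (Y ≅ Y') := by
  obtain ⟨b, hb₁, hb₂⟩ : ∃ b : Y ⟶ Y', p ≫ b = 𝟙 X ≫ p' ∧ q ≫ 𝟙 Z = b ≫ q' :=
    complete_distinguished_triangle_morphism₂ _ _ hT hT' (𝟙 X) (𝟙 Z)
    (by
      change r ≫ (𝟙 X)⟦(1 : ℤ)⟧' = 𝟙 Z ≫ r
      rw [CategoryTheory.Functor.map_id, Category.comp_id, Category.id_comp])
  let φ : Triangle.mk p q r ⟶ Triangle.mk p' q' r := Triangle.homMk _ _ (𝟙 X) b (𝟙 Z) hb₁ hb₂ (by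
    change r ≫ (𝟙 X)⟦(1 : ℤ)⟧' = 𝟙 Z ≫ r
    rw [CategoryTheory.Functor.map_id, Category.comp_id, Category.id_comp])
  have : IsIso b := isIso₂_of_isIso₁₃ φ hT hT' (inferInstanceAs (IsIso (𝟙 X)))
    (inferInstanceAs (IsIso (𝟙 Z)))
  exact ⟨asIso b⟩

namespace DerivedCategory

variable {B : Type u'} [Category.{w} B] [Abelian B] [HasDerivedCategory.{v} B]

/-- The shift by `n` of the object attached to `X` is concentrated in degree `-n`. -/
noncomputable def singleFunctorShiftIso (X : B) (n a a' : ℤ) (h : n + a = a') :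
    ((singleFunctor B a').obj X)⟦n⟧ ≅ (singleFunctor B a).obj X :=
  ((singleFunctors B).shiftIso n a a' h).app X

lemma singleFunctor_distTriang {X Y Z : B} {f : X ⟶ Y} {g : Y ⟶ Z} {w : f ≫ g = 0}
    (h : (ShortComplex.mk f g w).ShortExact) :
    Triangle.mk ((singleFunctor B 0).map f) ((singleFunctor B 0).map g) h.singleδ ∈
      distTriang (DerivedCategory B) :=
  h.singleTriangle_distinguished

end DerivedCategory

/-! ### The objects of the exact category as cells. -/

namespace ExactStructure

variable {A : Type u} [Category.{v} A] [Preadditive A] [HasZeroObject A] [HasBinaryBiproducts A]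
  (E : ExactStructure A)

/-- The cobase change of a conflation. -/
lemma exists_conflation_cobaseChange {K X Z K' : A} {k : K ⟶ X} {g : X ⟶ Z} {w : k ≫ g = 0}
    (h : E.conflation (ShortComplex.mk k g w)) (a : K ⟶ K') :
    ∃ (X' : A) (k' : K' ⟶ X') (g' : X' ⟶ Z) (b : X ⟶ X') (w' : k' ≫ g' = 0),
      E.conflation (ShortComplex.mk k' g' w') ∧ k ≫ b = a ≫ k' ∧ b ≫ g' = g := by
  obtain ⟨X', k', b, sq, hk'⟩ := E.cobaseChange k a ((E.inflation_iff k).2 ⟨_, g, w, h⟩)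
  let g' : X' ⟶ Z := sq.desc g 0 (by simp [w])
  have hb : b ≫ g' = g := sq.inl_desc _ _ _
  have hk : k' ≫ g' = 0 := sq.inr_desc _ _ _
  obtain ⟨Z', c, wc, hc⟩ := (E.inflation_iff k').1 hk'
  obtain ⟨hcok⟩ := E.isCokernel _ h
  obtain ⟨hcok'⟩ := E.isCokernel _ hc
  obtain ⟨u, hu⟩ : ∃ u : Z' ⟶ Z, c ≫ u = g' := ⟨_, hcok'.fac (CokernelCofork.ofπ g' hk) .one⟩
  obtain ⟨v, hv⟩ : ∃ v : Z ⟶ Z', g ≫ v = b ≫ c :=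
    ⟨_, hcok.fac (CokernelCofork.ofπ (b ≫ c) (show k ≫ b ≫ c = 0 by
      rw [sq.w_assoc, wc, comp_zero])) .one⟩
  have hgv : g' ≫ v = c := sq.hom_ext (by rw [reassoc_of% hb, hv])
    (by rw [reassoc_of% hk, zero_comp, wc])
  have hc_epi : Epi c := epi_of_isColimit_cofork hcok'
  have hg_epi : Epi g := epi_of_isColimit_cofork hcok
  let e : Z' ≅ Z := ⟨u, v, by rw [← cancel_epi c, reassoc_of% hu, hgv, Category.comp_id],
    by rw [← cancel_epi g, reassoc_of% hv, hu, hb, Category.comp_id]⟩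
  exact ⟨X', k', g', b, hk, E.conflation_of_iso (ShortComplex.isoMk (S₁ := ShortComplex.mk k' c wc)
    (S₂ := ShortComplex.mk k' g' hk) (Iso.refl _) (Iso.refl _) e (by simp) (by simp [e, hu])) hc,
    sq.w, hb⟩

end ExactStructure

section

open DerivedCategory ZeroObject

variable {A : Type u} [Category.{v} A] [Preadditive A] [HasZeroObject A]
  [HasBinaryBiproducts A] {E : ExactStructure A}
  {B : Type u'} [Category.{w} B] [Abelian B] {F : A ⥤ B} [F.Additive]

namespace IsCocompletion

universe w'
variable [HasDerivedCategory.{w'} B]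

/-- The lifting axiom refines the epimorphism of `exists_epi_comp_eq_zero` to a deflation. -/
lemma exists_conflation_comp_eq_zero (hF : IsCocompletion E F) {X : A} {W : DerivedCategory B}
    (hW : W.IsLE (-1))
    (f : (singleFunctor B 0).obj (F.obj X) ⟶ W) :
    ∃ (K X' : A) (k : K ⟶ X') (g : X' ⟶ X) (w : k ≫ g = 0),
      E.conflation (ShortComplex.mk k g w) ∧ (singleFunctor B 0).map (F.map g) ≫ f = 0 := by
  obtain ⟨U, p, hp, hpf⟩ := exists_epi_comp_eq_zero hW f
  obtain ⟨X', g, h, hg, hh⟩ := hF.exists_lift X p (𝟙 _)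
  obtain ⟨K, k, w, hk⟩ := (E.deflation_iff g).1 hg
  refine ⟨K, X', k, g, w, hk, ?_⟩
  rw [← Category.comp_id (F.map g), ← hh, Functor.map_comp, Category.assoc, hpf, comp_zero]

/-- An extension in the derived category of two objects of `A` is an object of `A`. -/
lemma exists_iso_of_distTriang (hF : IsCocompletion E F) {X Z : A} {Y : DerivedCategory B}
    {p : (singleFunctor B 0).obj (F.obj X) ⟶ Y} {q : Y ⟶ (singleFunctor B 0).obj (F.obj Z)}
    {r : (singleFunctor B 0).obj (F.obj Z) ⟶ ((singleFunctor B 0).obj (F.obj X))⟦(1 : ℤ)⟧}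
    (hT : Triangle.mk p q r ∈ distTriang (DerivedCategory B)) :
    ∃ Y₀ : A, Nonempty (Y ≅ (singleFunctor B 0).obj (F.obj Y₀)) := by
  have := hF.full
  obtain ⟨K, X', k, g, w, hk, hg⟩ := hF.exists_conflation_comp_eq_zero
    (TStructure.t.isLE_shift ((singleFunctor B 0).obj (F.obj X)) 0 1 (-1)) r
  have hS := (hF.conflation_iff _).1 hk
  -- Since `g` kills `r`, the class `r` is the pushforward of the class of the conflation along a
  -- map `K ⟶ X`, so `Y` is the cobase change of that conflation.
  obtain ⟨a', ha'⟩ := distTriang_desc₃ (singleFunctor_distTriang hS) r hg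
  obtain ⟨a'', rfl⟩ := (shiftFunctor (DerivedCategory B) (1 : ℤ)).map_surjective a'
  obtain ⟨a₀, rfl⟩ := (singleFunctor B 0).map_surjective a''
  obtain ⟨a, rfl⟩ := F.map_surjective a₀
  obtain ⟨Y₀, k', g', b, w', hk', hb, hb'⟩ := E.exists_conflation_cobaseChange hk a
  have hS' := (hF.conflation_iff _).1 hk'
  let φ : (ShortComplex.mk k g w).map F ⟶ (ShortComplex.mk k' g' w').map F :=
    F.mapShortComplex.map ⟨a, b, 𝟙 _, hb.symm, by simpa using hb'⟩
  have h := (ShortComplex.ShortExact.singleTriangle.map hS hS' φ).comm₃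
  have h' : hS'.singleδ = r := by
    rw [ha']
    refine Eq.trans ?_ h.symm
    change _ = (singleFunctor B 0).map (F.map (𝟙 Z)) ≫ hS'.singleδ
    rw [F.map_id, CategoryTheory.Functor.map_id]
    exact (Category.id_comp _).symm
  subst h'
  exact ⟨Y₀, (_root_.exists_iso_of_distTriang (singleFunctor_distTriang hS') hT).map Iso.symm⟩

/-- The cells attached to a cocompletion: the shifts of the objects of `A`. -/
noncomputable def cellFamily (hF : IsCocompletion E F) :
    CellFamily (TStructure.t (C := B)) where
  cell n X := ∃ X₀ : A, Nonempty (X ≅ (singleFunctor B (-n)).obj (F.obj X₀))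
  shift := by
    rintro n X a n' ⟨X₀, ⟨e⟩⟩ h
    exact ⟨X₀, ⟨(shiftFunctor _ a).mapIso e ≪≫ singleFunctorShiftIso _ _ _ _ (by lia)⟩⟩
  isLE := by
    rintro n X ⟨X₀, ⟨e⟩⟩
    exact TStructure.t.isLE_of_iso e.symm _
  exists_cell n := ⟨_, (0 : A), ⟨Iso.refl _⟩⟩
  ext := by
    rintro n X Y Z p q r hT ⟨X₀, ⟨e⟩⟩ ⟨Z₀, ⟨e'⟩⟩
    obtain ⟨r', hT'⟩ := distTriang_shift hT (-n)
    obtain ⟨Y₀, ⟨e₂⟩⟩ := hF.exists_iso_of_distTriang (exists_distTriang_of_iso hT'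
      ((shiftFunctor _ (-n)).mapIso e ≪≫ singleFunctorShiftIso (F.obj X₀) (-n) 0 (-n) (by lia))
      (Iso.refl _)
      ((shiftFunctor _ (-n)).mapIso e' ≪≫ singleFunctorShiftIso (F.obj Z₀) (-n) 0 (-n) (by lia)))
    exact ⟨Y₀, ⟨((shiftFunctorCompIsoId _ (-n) n (by lia)).app Y).symm ≪≫
      (shiftFunctor _ n).mapIso e₂ ≪≫ singleFunctorShiftIso _ n (-n) 0 (by lia)⟩⟩
  efface := by
    rintro n X W ⟨X₀, ⟨e⟩⟩ hW f
    let e₁ : ((singleFunctor B 0).obj (F.obj X₀))⟦n⟧ ≅ X :=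
      singleFunctorShiftIso _ n (-n) 0 (by lia) ≪≫ e.symm
    let e₂ : W⟦-n⟧⟦n⟧ ≅ W := (shiftFunctorCompIsoId _ (-n) n (by lia)).app W
    obtain ⟨f₀, hf₀⟩ := (shiftFunctor _ n).map_surjective (e₁.hom ≫ f ≫ e₂.inv)
    obtain ⟨K, X', k, g, w, hk, hg⟩ := hF.exists_conflation_comp_eq_zero
      (TStructure.t.isLE_shift W (-(n + 1)) (-n) (-1)) f₀
    have hT := singleFunctor_distTriang ((hF.conflation_iff _).1 hk)
    obtain ⟨g₀, hg₀⟩ := distTriang_desc₃ hT f₀ hg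
    obtain ⟨r', hT'⟩ := distTriang_shift (distTriang_rotate hT) n
    let e₃ : ((singleFunctor B 0).obj (F.obj K))⟦(1 : ℤ)⟧⟦n⟧ ≅
        (singleFunctor B (-(n + 1))).obj (F.obj K) :=
      (shiftFunctor _ n).mapIso (singleFunctorShiftIso _ 1 (-1) 0 (by lia)) ≪≫
        singleFunctorShiftIso _ n (-(n + 1)) (-1) (by lia)
    refine ⟨_, _, _, _, _, e₃.inv ≫ g₀⟦n⟧' ≫ e₂.hom,
      exists_distTriang_of_iso hT' (Iso.refl _) e₁ e₃,
      ⟨X', ⟨singleFunctorShiftIso _ n (-n) 0 (by lia)⟩⟩, ⟨K, ⟨Iso.refl _⟩⟩, ?_⟩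
    rw [hg₀, Functor.map_comp] at hf₀
    simp [reassoc_of% hf₀]

end IsCocompletion

end

/-! ### Commutation of `Hom` with colimits. -/

section HomColimit

universe v₁ u₁ v₂ u₂

variable {B : Type u₁} [Category.{v₁} B] {D : Type u₂} [Category.{v₂} D] [Preadditive D]

/-- The functor `Hom(Q, Φ(-))` commutes with the colimit of `Y` given by the cocone `c`. -/
structure HomCommutes {J : Type w} [Category.{v} J] (Y : J ⥤ B) (c : Cocone Y) (Φ : B ⥤ D) (Q : D) :
    Prop where
  surj : ∀ f : Q ⟶ Φ.obj c.pt, ∃ (j : J) (g : Q ⟶ Φ.obj (Y.obj j)), f = g ≫ Φ.map (c.ι.app j)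
  inj : ∀ (j : J) (g : Q ⟶ Φ.obj (Y.obj j)), g ≫ Φ.map (c.ι.app j) = 0 →
    ∃ (k : J) (u : j ⟶ k), g ≫ Φ.map (Y.map u) = 0

namespace HomCommutes

variable {J : Type w} [Category.{v} J] {Y : J ⥤ B} {c : Cocone Y} {Φ Ψ : B ⥤ D} {Q Q' : D}

lemma of_natIso (h : HomCommutes Y c Φ Q) (e : Φ ≅ Ψ) : HomCommutes Y c Ψ Q where
  surj f := by
    obtain ⟨j, g, hg⟩ := h.surj (f ≫ e.inv.app _)
    refine ⟨j, g ≫ e.hom.app _, ?_⟩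
    rw [Category.assoc, ← e.hom.naturality, ← reassoc_of% hg]
    simp
  inj j g hg := by
    obtain ⟨k, u, hu⟩ := h.inj j (g ≫ e.inv.app _) (by
      rw [Category.assoc, ← e.inv.naturality, reassoc_of% hg, zero_comp])
    refine ⟨k, u, ?_⟩
    rw [← cancel_mono (e.inv.app _), Category.assoc, e.inv.naturality, zero_comp, ← hu,
      Category.assoc]

lemma of_iso (h : HomCommutes Y c Φ Q) (e : Q ≅ Q') : HomCommutes Y c Φ Q' where
  surj f := by
    obtain ⟨j, g, hg⟩ := h.surj (e.hom ≫ f)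
    exact ⟨j, e.inv ≫ g, by rw [Category.assoc, ← hg, e.inv_hom_id_assoc]⟩
  inj j g hg := by
    obtain ⟨k, u, hu⟩ := h.inj j (e.hom ≫ g) (by rw [Category.assoc, hg, comp_zero])
    exact ⟨k, u, by rw [← cancel_epi e.hom, ← Category.assoc, hu, comp_zero]⟩

lemma of_subsingleton [Nonempty J] (h : ∀ (X : B) (f : Q ⟶ Φ.obj X), f = 0) :
    HomCommutes Y c Φ Q where
  surj f := ⟨Classical.arbitrary J, 0, by rw [h _ f, zero_comp]⟩
  inj j _ _ := ⟨j, 𝟙 j, h _ _⟩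

variable [HasShift D ℤ] [∀ n : ℤ, (shiftFunctor D n).Additive]

lemma shift (h : HomCommutes Y c Φ Q) (a : ℤ) :
    HomCommutes Y c (Φ ⋙ shiftFunctor D a) (Q⟦a⟧) where
  surj f := by
    obtain ⟨f, rfl⟩ := (shiftFunctor D a).map_surjective f
    obtain ⟨j, g, rfl⟩ := h.surj f
    exact ⟨j, g⟦a⟧', by simp⟩
  inj j g hg := by
    obtain ⟨g, rfl⟩ := (shiftFunctor D a).map_surjective g
    obtain ⟨k, u, hu⟩ := h.inj j g ((shiftFunctor D a).map_injective (by simpa using hg))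
    exact ⟨k, u, by rw [Functor.comp_map, ← Functor.map_comp, hu, Functor.map_zero]⟩

variable [HasZeroObject D] [Pretriangulated D] [IsFiltered J]

/-- The five lemma, for the behaviour of `Hom` with respect to colimits. -/
lemma of_distTriang {Q₁ Q₂ Q₃ : D} {p : Q₁ ⟶ Q₂} {q : Q₂ ⟶ Q₃} {r : Q₃ ⟶ Q₁⟦(1 : ℤ)⟧}
    (hT : Triangle.mk p q r ∈ distTriang D) (h₁ : HomCommutes Y c Φ Q₁)
    (h₁' : HomCommutes Y c Φ (Q₁⟦(1 : ℤ)⟧)) (h₃ : HomCommutes Y c Φ Q₃)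
    (h₃' : HomCommutes Y c (Φ ⋙ shiftFunctor D (1 : ℤ)) Q₃) : HomCommutes Y c Φ Q₂ where
  surj f := by
    obtain ⟨j, g, hg⟩ := h₁.surj (p ≫ f)
    -- The obstruction to extending `g` to `Q₂` vanishes in the colimit, hence at a later stage.
    obtain ⟨k, u, hu⟩ := h₃'.inj j (r ≫ g⟦(1 : ℤ)⟧') (by
      rw [Functor.comp_map, Category.assoc, ← Functor.map_comp, ← hg, Functor.map_comp,
        reassoc_of% (distTriang_comp₃₁ hT), zero_comp])
    obtain ⟨g', hg'⟩ := distTriang_desc₁ hT (g ≫ Φ.map (Y.map u)) (by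
      rw [Functor.map_comp, ← Category.assoc]; exact hu)
    obtain ⟨s, hs⟩ := distTriang_desc₂ hT
      (f - (g' ≫ Φ.map (c.ι.app k) : Q₂ ⟶ Φ.obj c.pt)) (by
      rw [Preadditive.comp_sub, hg, ← Category.assoc p, ← hg', Category.assoc, ← Φ.map_comp,
        c.w, sub_self])
    obtain ⟨l, s', rfl⟩ := h₃.surj s
    let m := IsFiltered.max k l
    refine ⟨m, g' ≫ Φ.map (Y.map (IsFiltered.leftToMax k l)) +
      q ≫ s' ≫ Φ.map (Y.map (IsFiltered.rightToMax k l)), ?_⟩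
    rw [Preadditive.add_comp, Category.assoc, Category.assoc, Category.assoc, ← Φ.map_comp,
      ← Φ.map_comp, c.w, c.w, ← hs, add_sub_cancel]
  inj j g hg := by
    obtain ⟨k, u, hu⟩ := h₁.inj j (p ≫ g) (by rw [Category.assoc, hg, comp_zero])
    obtain ⟨s, hs⟩ := distTriang_desc₂ hT (g ≫ Φ.map (Y.map u)) (by
      rw [← Category.assoc]; exact hu)
    obtain ⟨x, hx⟩ := distTriang_desc₃ hT (s ≫ Φ.map (c.ι.app k)) (by
      rw [← Category.assoc, ← hs, Category.assoc, ← Φ.map_comp, c.w, hg])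
    obtain ⟨l, x', rfl⟩ := h₁'.surj x
    let a := IsFiltered.leftToMax k l
    let b := IsFiltered.rightToMax k l
    obtain ⟨m, v, hv⟩ := h₃.inj _ (s ≫ Φ.map (Y.map a) - r ≫ x' ≫ Φ.map (Y.map b)) (by
      rw [Preadditive.sub_comp, Category.assoc, Category.assoc, Category.assoc, ← Φ.map_comp,
        ← Φ.map_comp, c.w, c.w, hx, sub_self])
    refine ⟨m, u ≫ a ≫ v, ?_⟩
    have h0 : q ≫ (s ≫ Φ.map (Y.map a) - r ≫ x' ≫ Φ.map (Y.map b)) ≫ Φ.map (Y.map v) = 0 := by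
      rw [hv, comp_zero]
    rw [Preadditive.sub_comp, Preadditive.comp_sub, Category.assoc r,
      reassoc_of% (distTriang_comp₂₃ hT), zero_comp, sub_zero, Category.assoc, ← Category.assoc q,
      ← hs] at h0
    simpa using h0

end HomCommutes

end HomColimit

/-! ### Pseudo-coherent objects, and the use of regularity. -/

section PseudoCoherent

open DerivedCategory

universe w'
variable {B : Type u'} [Category.{w} B] [Abelian B] [HasDerivedCategory.{w'} B]

/-- The morphisms from `Q` to the objects of `B` placed in cohomological degree `m` commute with
filtered colimits. -/
def IsPseudoCoherentAt (m : ℤ) (Q : DerivedCategory B) : Prop :=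
  ∀ (J : Type w) [SmallCategory J] [IsFiltered J] (Y : J ⥤ B) (c : Cocone Y),
    IsColimit c → HomCommutes Y c (singleFunctor B m) Q

variable (B) in
/-- Pseudo-coherent objects: those `Q` for which the functors `Hom(Q, -⟦n⟧)` from `B` commute with
filtered colimits. -/
def IsPseudoCoherent : ObjectProperty (DerivedCategory B) := fun Q ↦
  ∀ m : ℤ, IsPseudoCoherentAt m Q

lemma IsPseudoCoherentAt.shift {m : ℤ} {Q : DerivedCategory B} (h : IsPseudoCoherentAt m Q)
    (a m' : ℤ) (hm : a + m' = m) : IsPseudoCoherentAt m' (Q⟦a⟧) :=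
  fun J _ _ Y c hc ↦ ((h J Y c hc).shift a).of_natIso ((singleFunctors B).shiftIso a m' m hm)

lemma IsPseudoCoherentAt.of_iso {m : ℤ} {Q Q' : DerivedCategory B} (h : IsPseudoCoherentAt m Q)
    (e : Q ≅ Q') : IsPseudoCoherentAt m Q' :=
  fun J _ _ Y c hc ↦ (h J Y c hc).of_iso e

lemma IsPseudoCoherentAt.of_isLE {m : ℤ} {Q : DerivedCategory B} {n : ℤ} (hQ : Q.IsLE n)
    (hn : n < m) : IsPseudoCoherentAt m Q :=
  fun J _ _ _ _ _ ↦
    have := IsFiltered.nonempty (C := J)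
    HomCommutes.of_subsingleton fun _ f ↦ TStructure.t.zero f n m hn

lemma IsPseudoCoherentAt.of_distTriang {m : ℤ} {Q₁ Q₂ Q₃ : DerivedCategory B} {p : Q₁ ⟶ Q₂}
    {q : Q₂ ⟶ Q₃} {r : Q₃ ⟶ Q₁⟦(1 : ℤ)⟧}
    (hT : Triangle.mk p q r ∈ distTriang (DerivedCategory B)) (h₁ : IsPseudoCoherent B Q₁)
    (h₃ : IsPseudoCoherentAt m Q₃) (h₃' : IsPseudoCoherentAt (m - 1) Q₃) :
    IsPseudoCoherentAt m Q₂ :=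
  fun J _ _ Y c hc ↦ HomCommutes.of_distTriang hT (h₁ m J Y c hc)
    ((h₁ (m + 1)).shift 1 m (by lia) J Y c hc) (h₃ J Y c hc)
    ((h₃' J Y c hc).of_natIso ((singleFunctors B).shiftIso 1 (m - 1) m (by lia)).symm)

lemma IsPseudoCoherent.shift {Q : DerivedCategory B} (h : IsPseudoCoherent B Q) (a : ℤ) :
    IsPseudoCoherent B (Q⟦a⟧) :=
  fun m ↦ (h (a + m)).shift a m rfl

lemma IsPseudoCoherent.of_iso {Q Q' : DerivedCategory B} (h : IsPseudoCoherent B Q)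
    (e : Q ≅ Q') : IsPseudoCoherent B Q' :=
  fun m ↦ (h m).of_iso e

lemma IsPseudoCoherent.ext {Q₁ Q₂ Q₃ : DerivedCategory B} {p : Q₁ ⟶ Q₂}
    {q : Q₂ ⟶ Q₃} {r : Q₃ ⟶ Q₁⟦(1 : ℤ)⟧}
    (hT : Triangle.mk p q r ∈ distTriang (DerivedCategory B)) (h₁ : IsPseudoCoherent B Q₁)
    (h₃ : IsPseudoCoherent B Q₃) : IsPseudoCoherent B Q₂ :=
  fun m ↦ .of_distTriang hT h₁ (h₃ m) (h₃ (m - 1))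

/-- The fibre of a morphism between pseudo-coherent objects is pseudo-coherent. -/
lemma IsPseudoCoherent.fiber {Q₁ Q₂ Q₃ : DerivedCategory B} {p : Q₁ ⟶ Q₂}
    {q : Q₂ ⟶ Q₃} {r : Q₃ ⟶ Q₁⟦(1 : ℤ)⟧}
    (hT : Triangle.mk p q r ∈ distTriang (DerivedCategory B)) (h₂ : IsPseudoCoherent B Q₂)
    (h₃ : IsPseudoCoherent B Q₃) : IsPseudoCoherent B Q₁ :=
  ((IsPseudoCoherent.ext (distTriang_rotate (distTriang_rotate hT)) h₃ (h₂.shift 1)).shift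
    (-1)).of_iso ((shiftFunctorCompIsoId _ (1 : ℤ) (-1) (by simp)).app Q₁)

variable {A : Type u} [Category.{v} A] [Preadditive A] [HasZeroObject A]
  [HasBinaryBiproducts A] {E : ExactStructure A} {F : A ⥤ B} [F.Additive]

/-- Dimension shifting on the Ext degree `k`: for `k = 0` this is finite presentability, and
`efface` replaces a cell of degree `n` by cells of degree `n + 1`. -/
lemma IsPseudoCoherentAt.of_cell (hF : IsCocompletion E F) (k : ℕ) :
    ∀ {m n : ℤ} (_ : -m - n = k) {X : DerivedCategory B} (_ : hF.cellFamily.cell n X),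
      IsPseudoCoherentAt m X := by
  induction k with
  | zero =>
    rintro m n hmn X ⟨X₀, ⟨e⟩⟩
    obtain rfl : m = -n := by lia
    refine IsPseudoCoherentAt.of_iso (fun J _ _ Y c hc ↦ ?_) e.symm
    have := hF.finitelyPresented X₀
    constructor
    · intro f
      obtain ⟨f, rfl⟩ := (singleFunctor B (-n)).map_surjective f
      obtain ⟨j, g, rfl⟩ := IsFinitelyPresentable.exists_hom_of_isColimit hc f
      exact ⟨j, (singleFunctor B (-n)).map g, by simp⟩
    · intro j g hg
      obtain ⟨g, rfl⟩ := (singleFunctor B (-n)).map_surjective g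
      have hg' : g ≫ c.ι.app j = 0 :=
        (singleFunctor B (-n)).map_injective (by rw [Functor.map_comp, hg, Functor.map_zero])
      obtain ⟨k, a, b, h⟩ := IsFinitelyPresentable.exists_eq_of_isColimit hc g
        (0 : F.obj X₀ ⟶ Y.obj j) (by simpa using hg')
      exact ⟨k, a, by rw [← Functor.map_comp, h, zero_comp, Functor.map_zero]⟩
  | succ k ih =>
    intro m n hmn X hX J _ _ Y c hc
    have hm (V : B) : ((singleFunctor B m).obj V).IsLE (-(n + 1)) :=
      TStructure.t.isLE_of_le _ m _ (by lia)
    constructor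
    · intro f
      obtain ⟨X', K, p, q, r, g, hT, hX', hK, rfl⟩ := hF.cellFamily.efface hX (hm _) f
      obtain ⟨j, g', rfl⟩ := (ih (by lia) hK J Y c hc).surj g
      exact ⟨j, q ≫ g', by simp⟩
    · intro j f hf
      obtain ⟨X', K, p, q, r, g, hT, hX', hK, rfl⟩ := hF.cellFamily.efface hX (hm _) f
      -- Only `q ≫ g` dies in the colimit, not `g`. The defect factors through `r`; it is realised
      -- at a finite stage and subtracted, which is harmless because `q ≫ r = 0`.
      obtain ⟨x, hx⟩ := distTriang_desc₃ hT (g ≫ (singleFunctor B m).map (c.ι.app j)) (by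
        rw [← Category.assoc, hf])
      obtain ⟨l, x', rfl⟩ := (ih (m := m) (n := n + 1) (by lia)
        (hF.cellFamily.shift 1 (n + 1) hX' rfl) J Y c hc).surj x
      let a := IsFiltered.leftToMax j l
      let b := IsFiltered.rightToMax j l
      obtain ⟨i, v, hv⟩ := (ih (by lia) hK J Y c hc).inj _
        (g ≫ (singleFunctor B m).map (Y.map a) - r ≫ x' ≫ (singleFunctor B m).map (Y.map b)) (by
          rw [Preadditive.sub_comp, Category.assoc, Category.assoc, Category.assoc,
            ← Functor.map_comp, ← Functor.map_comp, c.w, c.w, hx, sub_self])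
      refine ⟨i, a ≫ v, ?_⟩
      have h0 := q ≫= hv
      rw [Preadditive.sub_comp, Preadditive.comp_sub, Category.assoc r,
        reassoc_of% (distTriang_comp₂₃ hT), zero_comp, sub_zero, comp_zero] at h0
      simpa using h0

lemma IsPseudoCoherent.of_cell (hF : IsCocompletion E F) {n : ℤ} {X : DerivedCategory B}
    (hX : hF.cellFamily.cell n X) : IsPseudoCoherent B X := by
  intro m
  by_cases h : -n < m
  · exact .of_isLE (hF.cellFamily.isLE hX) h
  · obtain ⟨k, hk⟩ := Int.eq_ofNat_of_zero_le (a := -m - n) (by lia)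
    exact .of_cell hF k hk hX

lemma IsPseudoCoherent.of_isFinite (hF : IsCocompletion E F) {T : DerivedCategory B}
    (hT : hF.cellFamily.IsFinite T) : IsPseudoCoherent B T := by
  induction hT with
  | zero hT => exact fun m J _ _ Y c _ ↦
      have := IsFiltered.nonempty (C := J)
      HomCommutes.of_subsingleton fun _ f ↦ hT.eq_of_src _ _
  | cell hT _ hX ih => exact .ext hT ih (.of_cell hF hX)

/-- The objects `W` of the derived category such that each morphism from a pseudo-coherent object
to `W` factors through a finite object. -/
def IsFinitelyReachable (hF : IsCocompletion E F) (W : DerivedCategory B) : Prop :=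
  ∀ ⦃Q : DerivedCategory B⦄, IsPseudoCoherent B Q → ∀ f : Q ⟶ W,
    ∃ (V : DerivedCategory B) (b : Q ⟶ V) (a : V ⟶ W), hF.cellFamily.IsFinite V ∧ f = b ≫ a

lemma IsFinitelyReachable.shift {hF : IsCocompletion E F} {W : DerivedCategory B}
    (h : IsFinitelyReachable hF W) (a : ℤ) : IsFinitelyReachable hF (W⟦a⟧) := by
  intro Q hQ f
  let e : Q⟦-a⟧⟦a⟧ ≅ Q := (shiftFunctorCompIsoId _ (-a) a (by lia)).app Q
  obtain ⟨f', hf'⟩ := (shiftFunctor _ a).map_surjective (e.hom ≫ f)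
  obtain ⟨V, b, c, hV, rfl⟩ := h (hQ.shift (-a)) f'
  refine ⟨V⟦a⟧, e.inv ≫ b⟦a⟧', c⟦a⟧', hV.shift a, ?_⟩
  rw [Category.assoc, ← Functor.map_comp, hf', e.inv_hom_id_assoc]

lemma IsFinitelyReachable.of_iso {hF : IsCocompletion E F} {W W' : DerivedCategory B}
    (h : IsFinitelyReachable hF W) (e : W ≅ W') : IsFinitelyReachable hF W' := by
  intro Q hQ f
  obtain ⟨V, b, c, hV, hf⟩ := h hQ (f ≫ e.inv)
  exact ⟨V, b, c ≫ e.hom, hV, by rw [← Category.assoc, ← hf]; simp⟩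

/-- Factor `Q ⟶ Z` through a finite `V`. The fibre `Q'` of `Q ⟶ V` is again pseudo-coherent and its
map to `Y` lifts to `X`, hence factors through a finite object; cobase change extends this
factorisation to `Q`. -/
lemma IsFinitelyReachable.ext {hF : IsCocompletion E F} {X Y Z : DerivedCategory B} {p : X ⟶ Y}
    {q : Y ⟶ Z} {r : Z ⟶ X⟦(1 : ℤ)⟧} (hT : Triangle.mk p q r ∈ distTriang (DerivedCategory B))
    (hX : IsFinitelyReachable hF X) (hZ : IsFinitelyReachable hF Z) :
    IsFinitelyReachable hF Y := by
  intro Q hQ f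
  obtain ⟨V, b, a, hV, hf⟩ := hZ hQ (f ≫ q)
  obtain ⟨Q', i, s, hQ'⟩ := distinguished_cocone_triangle₁ b
  have hc : IsPseudoCoherent B Q' := .fiber hQ' hQ (.of_isFinite hF hV)
  obtain ⟨g, hg⟩ := distTriang_lift₂ hT (i ≫ f) (by
    rw [Category.assoc, hf, reassoc_of% (distTriang_comp₁₂ hQ'), zero_comp])
  obtain ⟨V', b', a', hV', rfl⟩ := hX hc g
  exact CellFamily.IsFinite.exists_factor hQ' hV f ⟨V', b', a' ≫ p, hV', by simpa using hg⟩

/-- If `A` is regular, then each morphism from a pseudo-coherent object to an object of `B` factors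
through a finite object. -/
lemma IsRegularExact.isFinitelyReachable (hF : IsCocompletion E F) (hreg : IsRegularExact F)
    (Y : B) : IsFinitelyReachable hF ((singleFunctor B 0).obj Y) := by
  refine hreg (fun Y ↦ IsFinitelyReachable hF ((singleFunctor B 0).obj Y)) ⟨?_, ?_, ?_⟩ ?_ ?_ Y
  · intro S hS h₂ h₃
    have hT := distTriang_rotate (distTriang_rotate (singleFunctor_distTriang hS))
    exact ((IsFinitelyReachable.ext hT h₃ (h₂.shift 1)).shift (-1)).of_iso
      ((shiftFunctorCompIsoId _ (1 : ℤ) (-1) (by simp)).app _)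
  · intro S hS h₁ h₃
    exact .ext (singleFunctor_distTriang hS) h₁ h₃
  · intro S hS h₁ h₂
    exact .ext (distTriang_rotate (singleFunctor_distTriang hS)) h₂ (h₁.shift 1)
  · rintro J _ _ D c ⟨hc⟩ h Q hQ f
    obtain ⟨j, g, rfl⟩ := (hQ 0 J D c hc).surj f
    obtain ⟨V, b, a, hV, rfl⟩ := h j hQ g
    exact ⟨V, b, a ≫ (singleFunctor B 0).map (c.ι.app j), hV, by simp⟩
  · intro X Q _ f
    exact ⟨_, f, 𝟙 _, .of_cell (n := 0) ⟨X, ⟨Iso.refl _⟩⟩, by simp⟩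

end PseudoCoherent

/-! ### Syzygies of large index are retracts of objects of the exact category. -/

section Syzygies

open DerivedCategory

universe w'

lemma isSummandOfObj_of_retract {A : Type u} [Category.{v} A] {B : Type u'} [Category.{w} B]
    [Abelian B] {F : A ⥤ B} {Z : B} {X : A} (h : Retract Z (F.obj X)) :
    IsSummandOfObj F Z := by
  let S := ShortComplex.mk (kernel.ι h.r) h.r (kernel.condition _)
  have hS : S.Exact := ShortComplex.exact_kernel _
  have : Mono S.f := inferInstanceAs (Mono (kernel.ι h.r))
  let s : S.Splitting := ShortComplex.Splitting.ofExactOfSection S hS h.i h.retract inferInstance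
  exact ⟨X, kernel h.r, ⟨biprod.braiding _ _ ≪≫ s.isoBinaryBiproduct.symm⟩⟩

section

variable {B : Type u'} [Category.{w} B] [Abelian B] [HasDerivedCategory.{w'} B]

/-- The distinguished triangle attached to a short exact sequence in any degree. -/
lemma exists_singleFunctor_distTriang {X Y Z : B} {f : X ⟶ Y} {g : Y ⟶ Z} {w : f ≫ g = 0}
    (h : (ShortComplex.mk f g w).ShortExact) (m m' : ℤ) (hm : m' + 1 = m) :
    ∃ (d : (singleFunctor B m).obj Z ⟶ (singleFunctor B m').obj X)
      (r : (singleFunctor B m').obj X ⟶ ((singleFunctor B m).obj Y)⟦(1 : ℤ)⟧),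
      Triangle.mk ((singleFunctor B m).map g) d r ∈ distTriang (DerivedCategory B) := by
  obtain ⟨r, hr⟩ := distTriang_shift (distTriang_rotate (singleFunctor_distTriang h)) (-m)
  have hT := exists_distTriang_of_iso hr (singleFunctorShiftIso Y (-m) m 0 (by lia))
    (singleFunctorShiftIso Z (-m) m 0 (by lia))
    ((shiftFunctor _ (-m)).mapIso (singleFunctorShiftIso X 1 (-1) 0 (by lia)) ≪≫
      singleFunctorShiftIso X (-m) m' (-1) (by lia))
  have hg : (singleFunctorShiftIso Y (-m) m 0 (by lia)).inv ≫
      ((singleFunctor B 0).map g)⟦-m⟧' ≫ (singleFunctorShiftIso Z (-m) m 0 (by lia)).hom =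
      (singleFunctor B m).map g := by
    rw [Iso.inv_comp_eq]
    exact ((singleFunctors B).shiftIso (-m) m 0 (by lia)).hom.naturality g
  rw [hg] at hT
  exact ⟨_, _, hT⟩

end

variable {A : Type u} [Category.{v} A] [Preadditive A] [HasZeroObject A]
  [HasBinaryBiproducts A] {E : ExactStructure A}
  {B : Type u'} [Category.{w} B] [Abelian B] {F : A ⥤ B} [F.Additive]

variable {Z : ℕ → B} {C : ℕ → A} {i : ∀ k, Z (k + 1) ⟶ F.obj (C k)} {p : ∀ k, F.obj (C k) ⟶ Z k}
  {zero : ∀ k, i k ≫ p k = 0}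

section

variable [HasDerivedCategory.{w'} B]

lemma exists_retract_of_cell (hF : IsCocompletion E F) {n : ℤ} {Z : B} {T : DerivedCategory B}
    (hT : hF.cellFamily.cell n T) (h : Retract ((singleFunctor B (-n)).obj Z) T) :
    ∃ X : A, Nonempty (Retract Z (F.obj X)) := by
  obtain ⟨X, ⟨e⟩⟩ := hT
  obtain ⟨i, hi⟩ := (singleFunctor B (-n)).map_surjective (h.i ≫ e.hom)
  obtain ⟨r, hr⟩ := (singleFunctor B (-n)).map_surjective (e.inv ≫ h.r)
  refine ⟨X, ⟨i, r, (singleFunctor B (-n)).map_injective ?_⟩⟩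
  rw [Functor.map_comp, hi, hr]
  simp

/-- The kernel of an epimorphism between objects of `A` is a direct summand of an object of `A`. -/
lemma exists_retract_of_shortExact (hF : IsCocompletion E F) {Y X : A} {N : B}
    {n : N ⟶ F.obj Y} {c : F.obj Y ⟶ F.obj X} {w : n ≫ c = 0}
    (hS : (ShortComplex.mk n c w).ShortExact) :
    ∃ X' : A, Nonempty (Retract N (F.obj X')) := by
  have : Epi c := hS.epi_g
  obtain ⟨X', g, h, hg, hh⟩ := hF.exists_lift X c (𝟙 _)
  rw [Category.comp_id] at hh
  obtain ⟨K, k, w', hk⟩ := (E.deflation_iff g).1 hg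
  obtain ⟨d, r, hT⟩ := exists_singleFunctor_distTriang hS 0 (-1) (by lia)
  have hT' := distTriang_rotate (singleFunctor_distTriang ((hF.conflation_iff _).1 hk))
  have hd : (singleFunctor B 0).map c ≫ d = 0 := distTriang_comp₁₂ hT
  -- As `F.map g` factors through `c`, it is killed by the connecting map `d`, which therefore
  -- factors through the cell `K⟦1⟧`.
  have hgd : (singleFunctor B 0).map (F.map g) ≫ d = 0 := by
    rw [← hh, Functor.map_comp, Category.assoc, hd, comp_zero]
  obtain ⟨T, hT, ⟨hr⟩⟩ := hF.cellFamily.exists_retract_cell (n := 0) (n' := 1) hT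
    (distTriang_rotate hT') ⟨Y, ⟨Iso.refl _⟩⟩
    ⟨K, ⟨singleFunctorShiftIso _ 1 (-1) 0 (by lia)⟩⟩ (by
      have : (-((singleFunctor B 0).map (F.map g))⟦(1 : ℤ)⟧') ≫ d⟦(1 : ℤ)⟧' = 0 := by
        rw [Preadditive.neg_comp, ← Functor.map_comp, hgd, Functor.map_zero, neg_zero]
      exact this)
  exact exists_retract_of_cell hF hT hr

/-- The cone of the iterated connecting morphism from `Z 0` to `(Z k)⟦k⟧`. -/
lemma exists_syzygy_cone (hF : IsCocompletion E F)
    (hS : ∀ k, (ShortComplex.mk (i k) (p k) (zero k)).ShortExact) (k : ℕ) :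
    ∃ (f : (singleFunctor B (-((0 : ℕ) : ℤ))).obj (Z 0) ⟶ (singleFunctor B (-(k : ℤ))).obj (Z k))
      (R : DerivedCategory B) (a : (singleFunctor B (-(k : ℤ))).obj (Z k) ⟶ R)
      (b : R ⟶ ((singleFunctor B (-((0 : ℕ) : ℤ))).obj (Z 0))⟦(1 : ℤ)⟧),
      Triangle.mk f a b ∈ distTriang (DerivedCategory B) ∧ hF.cellFamily.IsFinite R ∧
        hF.cellFamily.DimLE (k + 1) R := by
  induction k with
  | zero =>
    exact ⟨𝟙 _, _, _, _, contractible_distinguished _, .zero (isZero_zero _),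
      .of_isZero (isZero_zero _) _⟩
  | succ k ih =>
    obtain ⟨f, R, a, b, hT, hR, hR'⟩ := ih
    obtain ⟨d, r, hd⟩ := exists_singleFunctor_distTriang (hS k) (-(k : ℤ)) (-((k + 1 : ℕ) : ℤ))
      (by push_cast; lia)
    obtain ⟨R', a', b', hT'⟩ := distinguished_cocone_triangle (f ≫ d)
    have o := someOctahedron rfl hT (distTriang_rotate hd) hT'
    have hc : hF.cellFamily.cell (k + 1)
        (((singleFunctor B (-(k : ℤ))).obj (F.obj (C k)))⟦(1 : ℤ)⟧) :=
      hF.cellFamily.shift 1 _ ⟨_, ⟨Iso.refl _⟩⟩ rfl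
    exact ⟨f ≫ d, R', a', b', hT', .cell o.mem hR hc, .of_distTriang_cell o.mem hR' hc (by simp)⟩

/-- The object `(Z 0)⟦1⟧` is an extension of `(Z k)⟦k + 1⟧` by a finite object, and for `k` large
the former has no nonzero map to the degrees under test, `m` and `m - 1`. -/
lemma isPseudoCoherent_of_shortExact (hF : IsCocompletion E F)
    (hS : ∀ k, (ShortComplex.mk (i k) (p k) (zero k)).ShortExact) :
    IsPseudoCoherent B ((singleFunctor B (-((0 : ℕ) : ℤ))).obj (Z 0)) := by
  refine IsPseudoCoherent.of_iso (IsPseudoCoherent.shift (fun m ↦ ?_) (-1))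
    ((shiftFunctorCompIsoId _ (1 : ℤ) (-1) (by simp)).app _)
  obtain ⟨k, hk⟩ : ∃ k : ℕ, -(k : ℤ) - 1 < m - 1 := ⟨(1 - m).toNat, by lia⟩
  obtain ⟨f, R, a, b, hT, hR, -⟩ := exists_syzygy_cone hF hS k
  have hle : (((singleFunctor B (-(k : ℤ))).obj (Z k))⟦(1 : ℤ)⟧).IsLE (-(k : ℤ) - 1) :=
    TStructure.t.isLE_shift _ (-(k : ℤ)) 1 _
  exact .of_distTriang (distTriang_rotate (distTriang_rotate hT)) (.of_isFinite hF hR)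
    (.of_isLE hle (by lia)) (.of_isLE hle hk)

/-- Regularity applied to the identity of `Z 0` makes `Z 0` a retract of a finite object. -/
lemma exists_dimLE_of_shortExact (hF : IsCocompletion E F)
    (hS : ∀ k, (ShortComplex.mk (i k) (p k) (zero k)).ShortExact)
    (hreg : IsRegularExact F) :
    ∃ N : ℤ, ∀ n ≥ N,
      hF.cellFamily.DimLE n ((singleFunctor B (-((0 : ℕ) : ℤ))).obj (Z 0)) := by
  have h := (hreg.isFinitelyReachable hF (Z 0)).of_iso (W' :=
    (singleFunctor B (-((0 : ℕ) : ℤ))).obj (Z 0)) (eqToIso (by simp))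
  obtain ⟨V, b, a, hV, hba⟩ := h (isPseudoCoherent_of_shortExact hF hS) (𝟙 _)
  obtain ⟨N, hN⟩ := hV.exists_dimLE
  exact ⟨N, fun n hn ↦ (hN n hn).of_retract ⟨b, a, hba.symm⟩⟩

lemma exists_retract_syzygy (hF : IsCocompletion E F)
    (hS : ∀ k, (ShortComplex.mk (i k) (p k) (zero k)).ShortExact) {k : ℕ}
    (hk : hF.cellFamily.DimLE k ((singleFunctor B (-((0 : ℕ) : ℤ))).obj (Z 0))) :
    ∃ X : A, Nonempty (Retract (Z (k + 1)) (F.obj X)) := by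
  obtain ⟨f, R, a, b, hT, -, hR⟩ := exists_syzygy_cone hF hS k
  -- The map `f` factors through a cell `X⟦k⟧`; adding `X` to `C k` makes `f` lift along `π`.
  obtain ⟨T, f₁, f₂, ⟨X, ⟨e⟩⟩, hf⟩ := hk inferInstance f
  obtain ⟨x, hx⟩ := (singleFunctor B (-(k : ℤ))).map_surjective (e.inv ≫ f₂)
  let π : F.obj (C k ⊞ X) ⟶ Z k := F.map biprod.fst ≫ p k + F.map biprod.snd ≫ x
  have hπ₁ : F.map biprod.inl ≫ π = p k := by
    simp [π, ← Functor.map_comp_assoc]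
  have hπ₂ : F.map biprod.inr ≫ π = x := by
    simp [π, ← Functor.map_comp_assoc]
  have hp : Epi (p k) := (hS k).epi_g
  have hπ : Epi π := by
    have : Epi (F.map biprod.inl ≫ π) := by rw [hπ₁]; exact hp
    exact epi_of_epi (F.map biprod.inl) π
  have hQ : (ShortComplex.mk (kernel.ι π) π (kernel.condition π)).ShortExact :=
    { exact := ShortComplex.exact_kernel π
      mono_f := inferInstanceAs (Mono (kernel.ι π))
      epi_g := hπ }
  obtain ⟨Y, ⟨ρ⟩⟩ : ∃ Y : A, Nonempty (Retract (kernel π) (F.obj Y)) := by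
    obtain ⟨q, r, hq⟩ := exists_singleFunctor_distTriang hQ (-(k : ℤ)) (-((k : ℤ) + 1)) (by lia)
    have hπq : (singleFunctor B (-(k : ℤ))).map π ≫ q = 0 := distTriang_comp₁₂ hq
    have hfq : f ≫ q = 0 := by
      rw [hf, ← e.hom_inv_id_assoc f₂, ← hx, ← hπ₂, Functor.map_comp]
      simp [hπq]
    -- The connecting map `q` of `π` kills `f`, so it factors through the cone `R`, and then through
    -- a cell of degree `k + 1` by the bound on the dimension of `R`.
    obtain ⟨q', rfl⟩ := distTriang_desc₂ hT q hfq
    obtain ⟨K, s, s', hK, rfl⟩ := hR inferInstance q'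
    obtain ⟨L, l, m, hL⟩ := distinguished_cocone_triangle (a ≫ s)
    have hm : m ≫ (a ≫ s)⟦(1 : ℤ)⟧' = 0 := distTriang_comp₃₁ hL
    obtain ⟨T', hT', ⟨ρ⟩⟩ := hF.cellFamily.exists_retract_cell (n := k) (n' := k + 1) hq hL
      ⟨_, ⟨Iso.refl _⟩⟩ hK (by
        rw [← Category.assoc a, Functor.map_comp, reassoc_of% hm, zero_comp])
    exact exists_retract_of_cell hF hT' ρ
  -- The kernel of `c` is `Z (k + 1)`, and `c` is an epimorphism because `p k` is one.
  let c : kernel π ⟶ F.obj X := kernel.ι π ≫ F.map biprod.snd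
  have hc : Epi c := by
    rw [epi_iff_surjective_up_to_refinements]
    intro V y
    obtain ⟨V', φ, hφ, z, hz⟩ := surjective_up_to_refinements_of_epi (p k) (y ≫ x)
    refine ⟨V', φ, hφ, kernel.lift π ((φ ≫ y) ≫ F.map biprod.inr - z ≫ F.map biprod.inl) ?_, ?_⟩
    · rw [Preadditive.sub_comp, Category.assoc, Category.assoc, Category.assoc, hπ₁, hπ₂, hz,
        sub_self]
    · simp [c, ← Functor.map_comp]
  -- Precomposing with the retraction `ρ.r` gives an epimorphism between objects of `A`, and `Z (k +
  -- 1)` is a retract of its kernel.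
  have hN : (ShortComplex.mk (kernel.ι (ρ.r ≫ c)) (ρ.r ≫ c) (kernel.condition _)).ShortExact :=
    { exact := ShortComplex.exact_kernel _
      mono_f := inferInstanceAs (Mono (kernel.ι (ρ.r ≫ c)))
      epi_g := inferInstanceAs (Epi (ρ.r ≫ c)) }
  obtain ⟨X', ⟨σ⟩⟩ := exists_retract_of_shortExact hF hN
  let j : Z (k + 1) ⟶ kernel π := kernel.lift π (i k ≫ F.map biprod.inl) (by
    rw [Category.assoc, hπ₁, zero k])
  have hj : j ≫ c = 0 := by
    simp [j, c, ← Functor.map_comp]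
  let j' : Z (k + 1) ⟶ kernel (ρ.r ≫ c) := kernel.lift _ (j ≫ ρ.i) (by simp [hj])
  let t : kernel (ρ.r ≫ c) ⟶ F.obj (C k) :=
    kernel.ι (ρ.r ≫ c) ≫ ρ.r ≫ kernel.ι π ≫ F.map biprod.fst
  have ht : t ≫ p k = 0 := by
    have h₁ : kernel.ι (ρ.r ≫ c) ≫ ρ.r ≫ kernel.ι π ≫ F.map biprod.snd = 0 := by
      simp [c]
    have h₂ : kernel.ι (ρ.r ≫ c) ≫ ρ.r ≫ kernel.ι π ≫ π = 0 := by simp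
    simpa [π, t, reassoc_of% h₁] using h₂
  have : Mono (i k) := (hS k).mono_f
  obtain ⟨t', ht'⟩ : ∃ t' : kernel (ρ.r ≫ c) ⟶ Z (k + 1), t' ≫ i k = t :=
    ⟨(hS k).exact.lift t ht, (hS k).exact.lift_f t ht⟩
  have hjt : j' ≫ t' = 𝟙 _ := by
    rw [← cancel_mono (i k), Category.assoc, ht']
    simp [j', t, j, ← Functor.map_comp]
  exact ⟨X', ⟨(Retract.mk j' t' hjt).trans σ⟩⟩

end

/-- In a sequence of syzygies of objects of `A`, all but finitely many are direct summands of
objects of `A`. -/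
theorem exists_isSummandOfObj_of_shortExact (hF : IsCocompletion E F)
    (hS : ∀ k, (ShortComplex.mk (i k) (p k) (zero k)).ShortExact)
    (hreg : IsRegularExact F) :
    ∃ n : ℕ, ∀ k ≥ n, IsSummandOfObj F (Z k) := by
  let _ := HasDerivedCategory.standard B
  obtain ⟨N, hN⟩ := exists_dimLE_of_shortExact hF hS hreg
  -- The extra one appears because dimension `≤ k` controls the syzygy of index `k + 1`.
  refine ⟨N.toNat + 1, fun k hk ↦ ?_⟩
  obtain ⟨k, rfl⟩ : ∃ l, k = l + 1 := ⟨k - 1, by lia⟩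
  obtain ⟨X, ⟨h⟩⟩ := exists_retract_syzygy hF hS (hN k (by lia))
  exact isSummandOfObj_of_retract h

end Syzygies

/-! ### From complexes to sequences of syzygies. -/

section KernelSequences

variable {B : Type u'} [Category.{w} B] [Abelian B]

lemma shortExact_kernel_lift {X Y Z : B} {f : X ⟶ Y} {g : Y ⟶ Z} (zero : f ≫ g = 0)
    (h : (ShortComplex.mk f g zero).Exact) :
    ∃ w : kernel.ι f ≫ kernel.lift g f zero = 0,
      (ShortComplex.mk (kernel.ι f) (kernel.lift g f zero) w).ShortExact := by
  have w : kernel.ι f ≫ kernel.lift g f zero = 0 := by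
    rw [← cancel_mono (kernel.ι g)]; simp
  have : Epi (kernel.lift g f zero) := (ShortComplex.exact_iff_epi_kernel_lift _).1 h
  refine ⟨w, ShortComplex.ShortExact.mk' ?_ inferInstance this⟩
  refine ShortComplex.exact_of_f_is_kernel _ (KernelFork.IsLimit.ofι' _ _ fun {T} k hk ↦ ?_)
  have hk' : k ≫ kernel.lift g f zero = 0 := hk
  have hkf : k ≫ f = 0 := by simpa using hk' =≫ kernel.ι g
  exact ⟨kernel.lift f k hkf, kernel.lift_ι f k hkf⟩

lemma exists_shortExact_of_exactAt_int (K : ChainComplex B ℤ) (j j' : ℤ) (h : j - 1 = j')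
    (hK : K.ExactAt j') :
    ∃ (i : kernel (K.d j (j - 1)) ⟶ K.X j) (p : K.X j ⟶ kernel (K.d j' (j' - 1)))
      (w : i ≫ p = 0), (ShortComplex.mk i p w).ShortExact := by
  subst h
  rw [K.exactAt_iff' j (j - 1) (j - 1 - 1) (by simp) (by simp)] at hK
  obtain ⟨w, hw⟩ := shortExact_kernel_lift _ hK
  exact ⟨_, _, w, hw⟩

lemma exists_shortExact_of_exactAt_nat (K : ChainComplex B ℕ) (k : ℕ) (hK : K.ExactAt (k + 1)) :
    ∃ (i : kernel (K.d (k + 2) (k + 1)) ⟶ K.X (k + 2))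
      (p : K.X (k + 2) ⟶ kernel (K.d (k + 1) k))
      (w : i ≫ p = 0), (ShortComplex.mk i p w).ShortExact := by
  rw [K.exactAt_iff' (k + 2) (k + 1) k (by simp) (by simp)] at hK
  obtain ⟨w, hw⟩ := shortExact_kernel_lift _ hK
  exact ⟨_, _, w, hw⟩

end KernelSequences

theorem mainTheorem5 {A : Type u} [Category.{v} A] [Preadditive A] [HasZeroObject A]
    [HasBinaryBiproducts A] [EssentiallySmall.{w} A] (E : ExactStructure A)
    {B : Type u'} [Category.{w} B] [Abelian B] (F : A ⥤ B) [F.Additive]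
    (hF : IsCocompletion E F) (hreg : IsRegularExact F) :
    (∀ C : ChainComplex A ℤ,
      (∃ a : ℤ, ∀ i ≥ a, IsZero (((F.mapHomologicalComplex _).obj C).homology i)) →
      ∃ n : ℤ, ∀ i ≥ n, IsSummandOfObj F (kernel (F.map (C.d i (i - 1))))) ∧
    (∀ (M : B) (R : ObjResolution F M),
      ∃ n : ℕ, ∀ i ≥ n, IsSummandOfObj F (kernel (F.map (R.complex.d (i + 1) i)))) := by
  constructor
  · rintro C ⟨a, ha⟩
    -- Exactness in degree `a + k` makes the kernel there a quotient of the term of degree `a + k +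
    -- 1`, so the syzygies start at degree `a`.
    have h (k : ℕ) := exists_shortExact_of_exactAt_int ((F.mapHomologicalComplex _).obj C)
      (a + (k + 1 : ℕ)) (a + k) (by push_cast; lia)
      ((HomologicalComplex.exactAt_iff_isZero_homology _ _).2 (ha _ (by lia)))
    choose i p w hS using h
    obtain ⟨n, hn⟩ := exists_isSummandOfObj_of_shortExact
      (Z := fun k : ℕ ↦ kernel (F.map (C.d (a + k) (a + k - 1))))
      (C := fun k : ℕ ↦ C.X (a + (k + 1 : ℕ))) hF hS hreg
    refine ⟨a + n, fun j hj ↦ ?_⟩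
    obtain ⟨k, rfl⟩ : ∃ k : ℕ, j = a + k := ⟨(j - a).toNat, by lia⟩
    exact hn k (by lia)
  · intro M R
    have h (k : ℕ) := exists_shortExact_of_exactAt_nat ((F.mapHomologicalComplex _).obj R.complex)
      k (R.exact_succ k)
    choose i p w hS using h
    -- Here `Z 0` is the kernel of the differential from degree `1` to degree `0`.
    exact exists_isSummandOfObj_of_shortExact
      (Z := fun k : ℕ ↦ kernel (F.map (R.complex.d (k + 1) k)))
      (C := fun k : ℕ ↦ R.complex.X (k + 2)) hF hS hreg
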